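/- Let $\mathcal D$ be the space of smooth compactly supported vector fields $\mathbb R^3\to\mathbb R^3$, $\langle f,g\rangle=\int f\cdot g\,dx$, and let $\mathfrak W(\mathbb R^3)$ be the Weyl C*-algebra generated by unitaries $e^{iA(f)},e^{iE(g)}$ ($f,g\in\mathcal D$), each family being a representation of the additive group $\mathcal D$, with $e^{iA(f)}e^{iE(g)}=e^{i\langle f,g\rangle}e^{iE(g)}e^{iA(f)}$. Put $e^{iB(f)}=e^{iA(\operatorname{curl}f)}$ and $e^{i\,\mathrm{div}E(s)}=e^{iE(-\operatorname{grad}s)}$ for scalar test functions $s$. For $O\subset\mathbb R^3$ let $\mathfrak W(O)$ be the C*-subalgebra generated by the Weyl operators of test functions supported in $O$, and $\mathfrak A(O)\subset\mathfrak W(O)$ the subalgebra of elements invariant under all gauge transformations $\mathrm{Ad}\,e^{iE(\operatorname{grad}s)}$, $s$ a scalar test function on $\mathbb R^3$. Let $\mathscr X\subset\mathbb R^3$ be finite, $x_1,x_2\in\mathscr X$, and let $\gamma_0:[0,1]\to\mathbb R^3$ be a smooth injective path from $x_1$ to $x_2$. Let $R>0$ be such that $|\gamma_0(u)-x_j|\ge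 R\,u(1-u)$ for $u\in(0,1)$, $j=1,2$, and such that for $|y|<R$ the paths $\gamma_y(u)=\gamma_0(u)+u(1-u)y$ meet no point of $\mathscr X\setminus\{x_1,x_2\}$. Let $q\in\mathbb R$ and let $s$ be a real scalar test function supported in the open ball of radius $R$ about $0$ with $\int s=q$. For $0<u<1$ let $a_u(x)=\int dy\,s(y)\,\delta(x-\gamma_y(u))\,\dot\gamma_y(u)$, that is, $a_u(x)=(u(1-u))^{-3}s(y)\,\dot\gamma_{y}(u)$ with $y=(x-\gamma_0(u))/(u(1-u))$, and for $0<\varepsilon<\tfrac12$ let $b_\varepsilon(x)=\int_\varepsilon^{1-\varepsilon}a_u(x)\,du$. Then each $b_\varepsilon$ belongs to $\mathcal D$ and is supported in $\mathbb R^3\setminus\mathscr X$; the limits $\beta(A)=\lim_{\varepsilon\searrow0}e^{iA(b_\varepsilon)}Ae^{-iA(b_\varepsilon)}$ exist in norm for all $A\in\mathfrak A(\mathbb R^3)$ and define a $*$-automorphism $\beta=\beta_{q,x_1x_2}$ of $\mathfrak A(\mathbb R^3)$, which restricts to a $*$-automorphism of $\mathfrak A(\mathbb R^3\setminus\mathscr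 X)$. This restriction has the following properties. (i) $\beta(e^{i\,\mathrm{div}E(s')})=e^{i\,\mathrm{div}E(s')}$ for every scalar test function $s'$ supported in $\mathbb R^3\setminus\mathscr X$. (ii) Let $\tau\subset\mathbb R^3$ be a region that is the union of finitely many smooth, orientation preserving parametrized cubes $[0,1]^3\to\mathbb R^3$, injective on the open cube and with pairwise disjoint images of the open cubes, and let its boundary, the closed surface $\sigma=\partial\tau$, be contained in $\mathbb R^3\setminus\mathscr X$. Then there is $\delta>0$ such that for every scalar test function $s'$ supported in the open ball of radius $\delta$ about $0$ with $\int s'=1$ the function $g_\sigma(x)=\int_\sigma s'(x-z)\,n_\sigma(z)\,dS(z)$ ($n_\sigma$ the outward unit normal; the integral is the sum of the integrals over the oriented faces of the cubes) belongs to $\mathcal D$, is supported in $\mathbb R^3\setminus\mathscr X$, and $$\beta(e^{iE(g_\sigma)})=\begin{cases}e^{iq}\,e^{iE(g_\sigma)}&\text{if }x_1\in\tau,\ x_2\notin\tau,\\ e^{-iq}\,e^{iE(g_\sigma)}&\text{if }x_1\notin\tau,\ x_2\in\tau,\\ e^{iE(g_\sigma)}&\text{if }\tau\text{ contains neither or both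 of }x_1,x_2.\end{cases}$$ (iii) Let $O\subset\mathbb R^3$ be open with compact closure $\overline O\subset\mathbb R^3\setminus\mathscr X$, and let $\overline O$ be contractible to a point within $\mathbb R^3\setminus\mathscr X$ (for example, $\overline O$ is contractible, or is contained in a contractible subset of $\mathbb R^3\setminus\mathscr X$). Then there is $f_O\in\mathcal D$ supported in $\mathbb R^3\setminus\mathscr X$ such that $\beta(A)=e^{iB(f_O)}Ae^{-iB(f_O)}$ for all $A\in\mathfrak A(O)$. -/

import Mathlib

open MeasureTheory Set Filter Topology
open scoped ContDiff Distributions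

namespace GaugeBridge

noncomputable section

/-! ### Test functions and vector calculus on `ℝ³` -/

/-- Euclidean space `ℝ³`. -/
abbrev R3 : Type := EuclideanSpace ℝ (Fin 3)

/-- Real scalar test functions on `ℝ³`. -/
abbrev ScalarTest : Type := 𝓓((⊤ : TopologicalSpace.Opens R3), ℝ)

/-- Real vector-valued test functions on `ℝ³`. -/
abbrev VectorTest : Type := 𝓓((⊤ : TopologicalSpace.Opens R3), R3)

/-- The pairing `⟨f, g⟩ = ∫ f(x) · g(x) dx`. -/
def pairing (f g : VectorTest) : ℝ := ∫ x, inner ℝ (f x) (g x)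

/-- The vector product on `ℝ³`. -/
def cross (a b : R3) : R3 := WithLp.toLp 2 (crossProduct a.ofLp b.ofLp)

/-- The partial derivative `∂ⱼ fᵢ (x)`. -/
def partialDeriv (f : R3 → R3) (j i : Fin 3) (x : R3) : ℝ :=
  fderiv ℝ f x (EuclideanSpace.single j 1) i

/-- The curl of a vector field. -/
def curlFun (f : R3 → R3) (x : R3) : R3 :=
  !₂[partialDeriv f 1 2 x - partialDeriv f 2 1 x,
     partialDeriv f 2 0 x - partialDeriv f 0 2 x,
     partialDeriv f 0 1 x - partialDeriv f 1 0 x]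

theorem tsupport_gradient_subset (s : R3 → ℝ) : tsupport (gradient s) ⊆ tsupport s := by
  refine closure_minimal (fun x hx => ?_) (isClosed_tsupport s)
  by_contra h
  exact hx (by simp [gradient, fderiv_of_notMem_tsupport ℝ h])

theorem tsupport_curlFun_subset (f : R3 → R3) : tsupport (curlFun f) ⊆ tsupport f := by
  refine closure_minimal (fun x hx => ?_) (isClosed_tsupport f)
  by_contra h
  refine hx ?_
  ext i
  fin_cases i <;> simp [curlFun, partialDeriv, fderiv_of_notMem_tsupport ℝ h]

theorem contDiff_partialDeriv {f : R3 → R3} (hf : ContDiff ℝ ∞ f) (j i : Fin 3) :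
    ContDiff ℝ ∞ (partialDeriv f j i) := by
  have h : ContDiff ℝ ∞ fun x => fderiv ℝ f x (EuclideanSpace.single j 1) :=
    (hf.fderiv_right (m := ∞) le_rfl).clm_apply contDiff_const
  exact (contDiff_piLp 2).1 h i

/-- The gradient of a scalar test function. -/
def grad (s : ScalarTest) : VectorTest where
  toFun := gradient s
  contDiff' := (InnerProductSpace.toDual ℝ R3).symm.contDiff.comp
    (s.contDiff.fderiv_right (m := ∞) le_rfl)
  hasCompactSupport' := s.hasCompactSupport.mono'
    (subset_tsupport _ |>.trans (tsupport_gradient_subset s))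
  tsupport_subset' := fun _ _ => trivial

/-- The curl of a vector test function. -/
def curl (f : VectorTest) : VectorTest where
  toFun := curlFun f
  contDiff' := by
    have hf : ContDiff ℝ ∞ f := f.contDiff
    refine (contDiff_piLp 2).2 fun i => ?_
    fin_cases i
    · exact (contDiff_partialDeriv hf 1 2).sub (contDiff_partialDeriv hf 2 1)
    · exact (contDiff_partialDeriv hf 2 0).sub (contDiff_partialDeriv hf 0 2)
    · exact (contDiff_partialDeriv hf 0 1).sub (contDiff_partialDeriv hf 1 0)
  hasCompactSupport' := f.hasCompactSupport.mono'
    (subset_tsupport _ |>.trans (tsupport_curlFun_subset f))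
  tsupport_subset' := fun _ _ => trivial

/-! ### The Weyl algebra

The Weyl C*-algebra over `VectorTest × VectorTest` is realized in its regular representation on
`ℓ²(VectorTest × VectorTest)`. -/

/-- The unitary operator `(T ψ)(w) = c(w) ψ(e(w))` on `ℓ²(V)`, for a bijection `e` of `V` and
phases `c`. -/
def phasePerm {V : Type*} (c : V → Circle) (e : V ≃ V) :
    lp (fun _ : V => ℂ) 2 ≃ₗᵢ[ℂ] lp (fun _ : V => ℂ) 2 where
  toFun ψ := ⟨fun w => (c w : ℂ) * ψ (e w), by
    have h := (memℓp_gen_iff (by norm_num)).1 (lp.memℓp ψ)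
    refine (memℓp_gen_iff (by norm_num)).2 ?_
    simpa [Function.comp_def, Circle.norm_coe] using
      (e.summable_iff (f := fun w => ‖ψ w‖ ^ (2 : ENNReal).toReal)).2 h⟩
  invFun ψ := ⟨fun w => ((c (e.symm w))⁻¹ : Circle) * ψ (e.symm w), by
    have h := (memℓp_gen_iff (by norm_num)).1 (lp.memℓp ψ)
    refine (memℓp_gen_iff (by norm_num)).2 ?_
    simpa [Function.comp_def, Circle.norm_coe] using
      (e.symm.summable_iff (f := fun w => ‖ψ w‖ ^ (2 : ENNReal).toReal)).2 h⟩
  map_add' ψ φ := by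
    ext w
    exact mul_add _ _ _
  map_smul' z ψ := by
    ext w
    exact mul_left_comm _ _ _
  left_inv ψ := by
    ext w
    simp
  right_inv ψ := by
    ext w
    simp
  norm_map' ψ := by
    rw [lp.norm_eq_tsum_rpow (by norm_num), lp.norm_eq_tsum_rpow (by norm_num)]
    congr 1
    rw [← e.tsum_eq (fun w => ‖ψ w‖ ^ (2 : ENNReal).toReal)]
    exact tsum_congr fun w => by simp [Circle.norm_coe]

@[simp]
theorem phasePerm_apply {V : Type*} (c : V → Circle) (e : V ≃ V) (ψ : lp (fun _ : V => ℂ) 2)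
    (w : V) : phasePerm c e ψ w = (c w : ℂ) * ψ (e w) := rfl

/-- The representation space `ℓ²(VectorTest × VectorTest)`. -/
abbrev WeylSpace : Type := lp (fun _ : VectorTest × VectorTest => ℂ) 2

/-- Bounded operators on the representation space. -/
abbrev Op : Type := WeylSpace →L[ℂ] WeylSpace

/-- The unitary `e^{iA(f)}`, acting by `(e^{iA(f)} ψ)(h, k) = e^{i⟨f, k⟩} ψ(h - f, k)`. -/
def expA (f : VectorTest) : unitary Op :=
  Unitary.linearIsometryEquiv.symm
    (phasePerm (fun w => Circle.exp (pairing f w.2))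
      ((Equiv.subRight f).prodCongr (Equiv.refl VectorTest)))

/-- The unitary `e^{iE(g)}`, acting by `(e^{iE(g)} ψ)(h, k) = ψ(h, k - g)`. -/
def expE (g : VectorTest) : unitary Op :=
  Unitary.linearIsometryEquiv.symm
    (phasePerm 1 ((Equiv.refl VectorTest).prodCongr (Equiv.subRight g)))

/-- The unitary `e^{iB(f)}` of the magnetic field `B = curl A`. -/
def expB (f : VectorTest) : unitary Op := expA (curl f)

/-- The unitary `e^{i div E(s)}`, where `div E(s) = -E(grad s)`. -/
def expDivE (s : ScalarTest) : unitary Op := expE (-grad s)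

@[simp]
theorem expA_apply (f : VectorTest) (ψ : WeylSpace) (w : VectorTest × VectorTest) :
    (expA f : Op) ψ w = (Circle.exp (pairing f w.2) : ℂ) * ψ (w.1 - f, w.2) := rfl

@[simp]
theorem expE_apply (g : VectorTest) (ψ : WeylSpace) (w : VectorTest × VectorTest) :
    (expE g : Op) ψ w = ψ (w.1, w.2 - g) := by
  change ((1 : Circle) : ℂ) * ψ (w.1, w.2 - g) = _
  simp

theorem integrable_inner (f g : VectorTest) : Integrable fun x => inner ℝ (f x) (g x) := by
  refine (f.continuous.inner g.continuous).integrable_of_hasCompactSupport ?_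
  refine f.hasCompactSupport.mono fun x hx h => hx ?_
  simp [h]

theorem pairing_add_left (f f' g : VectorTest) :
    pairing (f + f') g = pairing f g + pairing f' g := by
  rw [pairing, pairing, pairing, ← integral_add (integrable_inner f g) (integrable_inner f' g)]
  exact integral_congr_ae (.of_forall fun x => inner_add_left _ _ _)

theorem pairing_sub_right (f g g' : VectorTest) :
    pairing f (g - g') = pairing f g - pairing f g' := by
  rw [pairing, pairing, pairing, ← integral_sub (integrable_inner f g) (integrable_inner f g')]
  exact integral_congr_ae (.of_forall fun x => inner_sub_right _ _ _)

theorem expA_add (f f' : VectorTest) : expA (f + f') = expA f * expA f' := by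
  refine Subtype.ext (ContinuousLinearMap.ext fun ψ => lp.ext (funext fun w => ?_))
  change (expA (f + f') : Op) ψ w = (expA f : Op) ((expA f' : Op) ψ) w
  simp only [expA_apply, pairing_add_left, Circle.exp_add, Circle.coe_mul, mul_assoc]
  rw [sub_sub]

theorem expE_add (g g' : VectorTest) : expE (g + g') = expE g * expE g' := by
  refine Subtype.ext (ContinuousLinearMap.ext fun ψ => lp.ext (funext fun w => ?_))
  change (expE (g + g') : Op) ψ w = (expE g : Op) ((expE g' : Op) ψ) w
  simp only [expE_apply]
  rw [sub_sub]

/-- The Weyl relations `e^{iA(f)} e^{iE(g)} = e^{i⟨f, g⟩} e^{iE(g)} e^{iA(f)}`. -/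
theorem expA_mul_expE (f g : VectorTest) :
    (expA f : Op) * (expE g : Op) =
      Complex.exp (Complex.I * pairing f g) • ((expE g : Op) * (expA f : Op)) := by
  refine ContinuousLinearMap.ext fun ψ => lp.ext (funext fun w => ?_)
  change (expA f : Op) ((expE g : Op) ψ) w =
    Complex.exp (Complex.I * pairing f g) * (expE g : Op) ((expA f : Op) ψ) w
  simp only [expA_apply, expE_apply, pairing_sub_right, Circle.coe_exp, ← mul_assoc,
    ← Complex.exp_add]
  congr 2
  push_cast
  ring

/-- The C*-algebra `𝔚(O)` generated by the Weyl operators of test functions supported in `O`. -/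
def weylAlgebra (O : Set R3) : StarSubalgebra ℂ Op :=
  (StarAlgebra.adjoin ℂ
    ({a : Op | ∃ f : VectorTest, tsupport f ⊆ O ∧ a = expA f} ∪
      {a : Op | ∃ g : VectorTest, tsupport g ⊆ O ∧ a = expE g})).topologicalClosure

/-- The adjoint action `Ad U (a) = U a U*` of a unitary. -/
def Ad (U : unitary Op) : Op ≃⋆ₐ[ℂ] Op := Unitary.conjStarAlgAut ℂ Op U

/-- The observable algebra `𝔄(O)`: the part of `𝔚(O)` that is invariant under all gauge
transformations `Ad e^{iE(grad s)}`, where `s` is any scalar test function. -/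
def observables (O : Set R3) : StarSubalgebra ℂ Op where
  carrier := {a | a ∈ weylAlgebra O ∧ ∀ s : ScalarTest, Ad (expE (grad s)) a = a}
  mul_mem' ha hb := ⟨mul_mem ha.1 hb.1, fun s => by rw [map_mul, ha.2 s, hb.2 s]⟩
  add_mem' ha hb := ⟨add_mem ha.1 hb.1, fun s => by rw [map_add, ha.2 s, hb.2 s]⟩
  algebraMap_mem' z := ⟨algebraMap_mem _ z, fun s => AlgHomClass.commutes _ z⟩
  star_mem' ha := ⟨star_mem ha.1, fun s => by rw [map_star, ha.2 s]⟩

theorem observables_mono {O O' : Set R3} (h : O ⊆ O') : observables O ≤ observables O' := by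
  refine fun a ha => ⟨StarSubalgebra.topologicalClosure_mono (StarAlgebra.adjoin_mono ?_) ha.1, ha.2⟩
  exact union_subset_union (fun _ ⟨f, hf, e⟩ => ⟨f, hf.trans h, e⟩)
    (fun _ ⟨g, hg, e⟩ => ⟨g, hg.trans h, e⟩)

theorem expE_mem_observables {O : Set R3} {g : VectorTest} (hg : tsupport g ⊆ O) :
    (expE g : Op) ∈ observables O := by
  refine ⟨StarSubalgebra.le_topologicalClosure _
    (StarAlgebra.subset_adjoin ℂ _ (Or.inr ⟨g, hg, rfl⟩)), fun s => ?_⟩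
  have h : expE (grad s) * expE g * star (expE (grad s)) = expE g := by
    rw [← expE_add, add_comm, expE_add, mul_assoc, Unitary.mul_star_self, mul_one]
  exact congrArg Subtype.val h

theorem tsupport_neg_grad_subset {O : Set R3} {s : ScalarTest} (hs : tsupport s ⊆ O) :
    tsupport (-grad s : VectorTest) ⊆ O := by
  have h : ((-grad s : VectorTest) : R3 → R3) = -gradient s := rfl
  rw [h, tsupport_neg]
  exact (tsupport_gradient_subset s).trans hs

/-- `e^{iE(g)}` as an element of `𝔄(O)`, for `g` supported in `O`. -/
def obsE (O : Set R3) (g : VectorTest) (hg : tsupport g ⊆ O) : observables O :=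
  ⟨expE g, expE_mem_observables hg⟩

/-- `e^{i div E(s)}` as an element of `𝔄(O)`, for `s` supported in `O`. -/
def obsDivE (O : Set R3) (s : ScalarTest) (hs : tsupport s ⊆ O) : observables O :=
  ⟨expDivE s, expE_mem_observables (tsupport_neg_grad_subset hs)⟩

/-! ### The test functions of a gauge bridge -/

/-- The neighbouring path `γ_y(u) = γ(u) + u(1 - u) y`. -/
def nbrPath (γ : ℝ → R3) (y : R3) (u : ℝ) : R3 := γ u + (u * (1 - u)) • y

/-- The function `a_u(x) = ∫ s(y) δ(x - γ_y(u)) γ_y'(u) dy` for `0 < u < 1`, where the Dirac measure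
is evaluated: `γ_y(u) = x` holds for `y = (u(1 - u))⁻¹ (x - γ(u))` only, and `y ↦ γ_y(u)` has the
Jacobian `(u(1 - u))³`. See `integral_bridgeDensity`. -/
def bridgeDensity (γ : ℝ → R3) (s : R3 → ℝ) (u : ℝ) (x : R3) : R3 :=
  let y : R3 := (u * (1 - u))⁻¹ • (x - γ u)
  (((u * (1 - u)) ^ 3)⁻¹ * s y) • deriv (nbrPath γ y) u

/-- The distributional meaning of `a_u`. -/
theorem integral_bridgeDensity (γ : ℝ → R3) (s : R3 → ℝ) {u : ℝ} (hu : u ∈ Ioo (0 : ℝ) 1)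
    (g : R3 → R3) :
    ∫ x, inner ℝ (bridgeDensity γ s u x) (g x) =
      ∫ y, s y * inner ℝ (deriv (nbrPath γ y) u) (g (nbrPath γ y u)) := by
  have hc : 0 < u * (1 - u) := mul_pos hu.1 (sub_pos.2 hu.2)
  set F : R3 → ℝ := fun x => inner ℝ (bridgeDensity γ s u x) (g x) with hF
  have h1 : ∫ x, F x = ∫ x, F (γ u + x) := (integral_add_left_eq_self F (γ u)).symm
  have h2 := Measure.integral_comp_smul (volume : Measure R3) (fun x => F (γ u + x)) (u * (1 - u))
  rw [finrank_euclideanSpace_fin, abs_of_pos (by positivity), smul_eq_mul] at h2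
  have h3 : ∫ x, F (γ u + x) = (u * (1 - u)) ^ 3 * ∫ y, F (γ u + (u * (1 - u)) • y) := by
    rw [h2, ← mul_assoc, mul_inv_cancel₀ (by positivity), one_mul]
  rw [h1, h3, ← integral_const_mul]
  refine integral_congr_ae (.of_forall fun y => ?_)
  have hy : (u * (1 - u))⁻¹ • (γ u + (u * (1 - u)) • y - γ u) = y := by
    rw [add_sub_cancel_left, smul_smul, inv_mul_cancel₀ hc.ne', one_smul]
  have hc3 : (u * (1 - u)) ^ 3 ≠ 0 := by positivity
  simp only [hF, bridgeDensity, hy, real_inner_smul_left]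
  rw [← mul_assoc, ← mul_assoc, mul_inv_cancel₀ hc3, one_mul]
  rfl

/-- The function `b_ε(x) = ∫_ε^{1-ε} a_u(x) du`. -/
def bridgeFun (γ : ℝ → R3) (s : R3 → ℝ) (ε : ℝ) (x : R3) : R3 :=
  ∫ u in ε..(1 - ε), bridgeDensity γ s u x

/-! ### Closed surfaces as boundaries of regions -/

/-- The matrix of partial derivatives of a map `τ` from the cube to `ℝ³`. -/
def jacobian (τ : (Fin 3 → ℝ) → R3) (u : Fin 3 → ℝ) : Matrix (Fin 3) (Fin 3) ℝ :=
  Matrix.of fun i j => fderiv ℝ τ u (Pi.single j 1) i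

/-- A region in `ℝ³`, given by finitely many non-overlapping smooth orientation preserving
parametrized cubes `[0,1]³ → ℝ³`. -/
structure Region where
  /-- The number of cubes. -/
  n : ℕ
  /-- The parametrizations; only their restrictions to `[0,1]³` matter. -/
  cell : Fin n → (Fin 3 → ℝ) → R3
  smooth : ∀ k, ContDiff ℝ ∞ (cell k)
  injOn : ∀ k, InjOn (cell k) (univ.pi fun _ => Ioo (0 : ℝ) 1)
  orientation : ∀ k, ∀ u ∈ univ.pi (fun _ : Fin 3 => Ioo (0 : ℝ) 1), 0 ≤ (jacobian (cell k) u).det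
  disjoint : Pairwise fun k l =>
    Disjoint (cell k '' univ.pi fun _ => Ioo (0 : ℝ) 1) (cell l '' univ.pi fun _ => Ioo (0 : ℝ) 1)

/-- The set of points of a region. -/
def Region.carrier (τ : Region) : Set R3 := ⋃ k, τ.cell k '' Icc 0 1

/-- The closed surface that bounds a region, as a set. -/
def Region.surface (τ : Region) : Set R3 := frontier τ.carrier

/-- The normal `n_σ = ∂₁σ × ∂₂σ` of a parametrized surface. -/
def normal (σ : (Fin 2 → ℝ) → R3) (u : Fin 2 → ℝ) : R3 :=
  cross (fderiv ℝ σ u (Pi.single 0 1)) (fderiv ℝ σ u (Pi.single 1 1))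

/-- The function `g_σ(x) = ∫_{[0,1]²} s(x - σ(u)) n_σ(u) d²u` of a parametrized surface `σ`. -/
def patchFun (s : R3 → ℝ) (σ : (Fin 2 → ℝ) → R3) (x : R3) : R3 :=
  ∫ u in Icc (0 : Fin 2 → ℝ) 1, s (x - σ u) • normal σ u

/-- The face `uᵢ = a` of a parametrized cube. -/
def face (τ : (Fin 3 → ℝ) → R3) (i : Fin 3) (a : ℝ) (u : Fin 2 → ℝ) : R3 := τ (i.insertNth a u)

/-- The function `g_σ` of the closed surface `σ = ∂τ`: the sum over the faces of the cubes, with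
their boundary orientation, so that the normal is outward. Common faces of two cubes cancel. -/
def Region.surfaceFun (τ : Region) (s : R3 → ℝ) (x : R3) : R3 :=
  ∑ k, ∑ i : Fin 3, (-1 : ℝ) ^ (i : ℕ) •
    (patchFun s (face (τ.cell k) i 1) x - patchFun s (face (τ.cell k) i 0) x)

/-! ### Contractibility of a region inside a larger one -/

/-- `K` is contained in `U` and can be contracted to a point within `U`. -/
def ContractibleIn (K U : Set R3) : Prop :=
  ∃ h : K ⊆ U, (ContinuousMap.inclusion h).Nullhomotopic

/-- A subset of a contractible subset of `U` can be contracted within `U`. -/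
theorem ContractibleIn.of_subset {K C U : Set R3} (hKC : K ⊆ C) (hCU : C ⊆ U)
    [ContractibleSpace C] : ContractibleIn K U :=
  ⟨hKC.trans hCU, ((id_nullhomotopic C).comp_right (ContinuousMap.inclusion hCU)).comp_left
    (ContinuousMap.inclusion hKC)⟩

end

end GaugeBridge

open GaugeBridge

namespace GaugeBridge

noncomputable section

/-! ### Phases attached to additive functionals of the electric test functions -/

/-- The unitary `(U ψ)(h, k) = e^{iℓ(k)} ψ(h, k)` of an additive functional `ℓ`. -/
def expFunctional (ℓ : VectorTest →+ ℝ) : unitary Op :=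
  Unitary.linearIsometryEquiv.symm
    (phasePerm (fun w => Circle.exp (ℓ w.2)) (Equiv.refl (VectorTest × VectorTest)))

@[simp]
theorem expFunctional_apply (ℓ : VectorTest →+ ℝ) (ψ : WeylSpace) (w : VectorTest × VectorTest) :
    (expFunctional ℓ : Op) ψ w = (Circle.exp (ℓ w.2) : ℂ) * ψ w := rfl

theorem expFunctional_add (ℓ ℓ' : VectorTest →+ ℝ) :
    expFunctional (ℓ + ℓ') = expFunctional ℓ * expFunctional ℓ' := by
  refine Subtype.ext (ContinuousLinearMap.ext fun ψ => lp.ext (funext fun w => ?_))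
  change (expFunctional (ℓ + ℓ') : Op) ψ w = (expFunctional ℓ : Op) ((expFunctional ℓ' : Op) ψ) w
  simp only [expFunctional_apply, AddMonoidHom.add_apply, Circle.exp_add, Circle.coe_mul, mul_assoc]

theorem expFunctional_zero : expFunctional 0 = 1 := by
  refine Subtype.ext (ContinuousLinearMap.ext fun ψ => lp.ext (funext fun w => ?_))
  change (expFunctional 0 : Op) ψ w = ψ w
  simp

theorem expFunctional_mul_expA (ℓ : VectorTest →+ ℝ) (f : VectorTest) :
    (expFunctional ℓ : Op) * expA f = expA f * expFunctional ℓ := by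
  refine ContinuousLinearMap.ext fun ψ => lp.ext (funext fun w => ?_)
  change (expFunctional ℓ : Op) ((expA f : Op) ψ) w = (expA f : Op) ((expFunctional ℓ : Op) ψ) w
  simp only [expFunctional_apply, expA_apply]
  ring

theorem expFunctional_mul_expE (ℓ : VectorTest →+ ℝ) (g : VectorTest) :
    (expFunctional ℓ : Op) * expE g =
      Complex.exp (Complex.I * ℓ g) • ((expE g : Op) * expFunctional ℓ) := by
  refine ContinuousLinearMap.ext fun ψ => lp.ext (funext fun w => ?_)
  change (expFunctional ℓ : Op) ((expE g : Op) ψ) w =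
    Complex.exp (Complex.I * ℓ g) * (expE g : Op) ((expFunctional ℓ : Op) ψ) w
  simp only [expFunctional_apply, expE_apply, map_sub, Circle.coe_exp, ← mul_assoc,
    ← Complex.exp_add]
  congr 2
  push_cast
  ring

theorem Ad_apply (U : unitary Op) (a : Op) : Ad U a = U * a * star (U : Op) := rfl

theorem Ad_mul_apply (U V : unitary Op) (a : Op) : Ad (U * V) a = Ad U (Ad V a) :=
  Unitary.conjStarAlgAut_mul_apply U V a

theorem Ad_one_apply (a : Op) : Ad 1 a = a := by simp [Ad_apply]

theorem Ad_apply_eq_smul {U : unitary Op} {a : Op} {z : ℂ} (h : (U : Op) * a = z • (a * U)) :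
    Ad U a = z • a := by
  rw [Ad_apply, h, smul_mul_assoc, mul_assoc, Unitary.mul_star_self_of_mem U.2, mul_one]

theorem isometry_Ad (U : unitary Op) : Isometry (Ad U) := by
  refine AddMonoidHomClass.isometry_of_norm (Ad U) fun a => ?_
  rw [Ad_apply, ← Unitary.coe_star, CStarRing.norm_mul_coe_unitary, CStarRing.norm_coe_unitary_mul]

theorem Ad_expFunctional_expA (ℓ : VectorTest →+ ℝ) (f : VectorTest) :
    Ad (expFunctional ℓ) (expA f) = expA f := by
  simpa using Ad_apply_eq_smul (z := 1)
    ((expFunctional_mul_expA ℓ f).trans (one_smul ℂ ((expA f : Op) * expFunctional ℓ)).symm)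

theorem Ad_expFunctional_expE (ℓ : VectorTest →+ ℝ) (g : VectorTest) :
    Ad (expFunctional ℓ) (expE g) = Complex.exp (Complex.I * ℓ g) • (expE g : Op) :=
  Ad_apply_eq_smul (expFunctional_mul_expE ℓ g)

theorem Ad_expA_expA (f f' : VectorTest) : Ad (expA f) (expA f') = expA f' := by
  have h : (expA f : Op) * expA f' = expA f' * expA f := by
    have := congrArg Subtype.val ((expA_add f f').symm.trans
      ((congrArg expA (add_comm f f')).trans (expA_add f' f)))
    exact this
  simpa using Ad_apply_eq_smul (z := 1) (h.trans (one_smul ℂ ((expA f' : Op) * expA f)).symm)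

theorem Ad_expA_expE (f g : VectorTest) :
    Ad (expA f) (expE g) = Complex.exp (Complex.I * pairing f g) • (expE g : Op) :=
  Ad_apply_eq_smul (expA_mul_expE f g)

theorem Ad_expE_Ad_expFunctional (ℓ : VectorTest →+ ℝ) (g : VectorTest) (a : Op) :
    Ad (expE g) (Ad (expFunctional ℓ) a) = Ad (expFunctional ℓ) (Ad (expE g) a) := by
  set z := Complex.exp (Complex.I * ℓ g) with hz
  have hzz : z * star z = 1 := by
    rw [Complex.star_def, Complex.mul_conj, Complex.normSq_eq_norm_sq, hz, mul_comm,
      Complex.norm_exp_ofReal_mul_I]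
    simp
  have h := expFunctional_mul_expE ℓ g
  rw [← Ad_mul_apply, ← Ad_mul_apply, Ad_apply, Ad_apply]
  have h' : ((expFunctional ℓ * expE g : unitary Op) : Op) =
      z • ((expE g * expFunctional ℓ : unitary Op) : Op) := h
  rw [h', star_smul, smul_mul_assoc, smul_mul_assoc, mul_smul_comm, smul_smul, hzz, one_smul]

theorem expA_mem_weylAlgebra {O : Set R3} {f : VectorTest} (hf : tsupport f ⊆ O) :
    (expA f : Op) ∈ weylAlgebra O :=
  StarSubalgebra.le_topologicalClosure _ (StarAlgebra.subset_adjoin ℂ _ (Or.inl ⟨f, hf, rfl⟩))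

theorem expE_mem_weylAlgebra {O : Set R3} {g : VectorTest} (hg : tsupport g ⊆ O) :
    (expE g : Op) ∈ weylAlgebra O :=
  (expE_mem_observables hg).1

/-- `𝔚(O)` is the smallest closed `*`-algebra that contains the Weyl operators of `O`. -/
theorem weylAlgebra_le {O : Set R3} {S : StarSubalgebra ℂ Op} (hS : IsClosed (S : Set Op))
    (hA : ∀ f : VectorTest, tsupport f ⊆ O → (expA f : Op) ∈ S)
    (hE : ∀ g : VectorTest, tsupport g ⊆ O → (expE g : Op) ∈ S) : weylAlgebra O ≤ S := by
  refine StarSubalgebra.topologicalClosure_minimal (StarAlgebra.adjoin_le ?_) hS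
  rintro a (⟨f, hf, rfl⟩ | ⟨g, hg, rfl⟩)
  exacts [hA f hf, hE g hg]

theorem isClosed_weylAlgebra (O : Set R3) : IsClosed (weylAlgebra O : Set Op) :=
  StarSubalgebra.isClosed_topologicalClosure _

theorem Ad_expFunctional_mem_weylAlgebra (ℓ : VectorTest →+ ℝ) {O : Set R3} {a : Op}
    (ha : a ∈ weylAlgebra O) : Ad (expFunctional ℓ) a ∈ weylAlgebra O := by
  have hle : weylAlgebra O ≤
      (weylAlgebra O).comap (Ad (expFunctional ℓ) : Op →⋆ₐ[ℂ] Op) := by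
    refine weylAlgebra_le ?_ (fun f hf => ?_) (fun g hg => ?_)
    · exact (isClosed_weylAlgebra O).preimage (isometry_Ad (expFunctional ℓ)).continuous
    · change Ad (expFunctional ℓ) (expA f) ∈ weylAlgebra O
      rw [Ad_expFunctional_expA]
      exact expA_mem_weylAlgebra hf
    · change Ad (expFunctional ℓ) (expE g) ∈ weylAlgebra O
      rw [Ad_expFunctional_expE]
      exact (weylAlgebra O).smul_mem (expE_mem_weylAlgebra hg) _
  exact hle ha

theorem Ad_expFunctional_mem_observables (ℓ : VectorTest →+ ℝ) {O : Set R3} {a : Op}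
    (ha : a ∈ observables O) : Ad (expFunctional ℓ) a ∈ observables O :=
  ⟨Ad_expFunctional_mem_weylAlgebra ℓ ha.1, fun s => by
    rw [Ad_expE_Ad_expFunctional, ha.2 s]⟩

/-- The `*`-endomorphism of `𝔄(O)` that an additive functional implements. -/
def functionalHom (ℓ : VectorTest →+ ℝ) (O : Set R3) : observables O →⋆ₐ[ℂ] observables O :=
  StarAlgHom.codRestrict ((Ad (expFunctional ℓ) : Op →⋆ₐ[ℂ] Op).comp (observables O).subtype)
    (observables O) fun a => Ad_expFunctional_mem_observables ℓ a.2

theorem functionalHom_comp_of_add_eq_zero {ℓ ℓ' : VectorTest →+ ℝ} (h : ℓ + ℓ' = 0) (O : Set R3) :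
    (functionalHom ℓ O).comp (functionalHom ℓ' O) = StarAlgHom.id ℂ (observables O) := by
  refine StarAlgHom.ext fun a => Subtype.ext ?_
  change Ad (expFunctional ℓ) (Ad (expFunctional ℓ') a) = a
  rw [← Ad_mul_apply, ← expFunctional_add, h, expFunctional_zero, Ad_one_apply]

/-- The `*`-automorphism of `𝔄(O)` that an additive functional implements. -/
def functionalAut (ℓ : VectorTest →+ ℝ) (O : Set R3) : observables O ≃⋆ₐ[ℂ] observables O :=
  StarAlgEquiv.ofStarAlgHom (functionalHom ℓ O) (functionalHom (-ℓ) O)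
    (functionalHom_comp_of_add_eq_zero (neg_add_cancel ℓ) O)
    (functionalHom_comp_of_add_eq_zero (add_neg_cancel ℓ) O)

theorem coe_functionalAut (ℓ : VectorTest →+ ℝ) (O : Set R3) (a : observables O) :
    (functionalAut ℓ O a : Op) = Ad (expFunctional ℓ) a := rfl

theorem functionalAut_obsE (ℓ : VectorTest →+ ℝ) (O : Set R3) (g : VectorTest)
    (hg : tsupport g ⊆ O) :
    functionalAut ℓ O (obsE O g hg) = Complex.exp (Complex.I * ℓ g) • obsE O g hg :=
  Subtype.ext (Ad_expFunctional_expE ℓ g)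

theorem functionalAut_obsE_of_eq_zero {ℓ : VectorTest →+ ℝ} {g : VectorTest} (h : ℓ g = 0)
    (O : Set R3) (hg : tsupport g ⊆ O) : functionalAut ℓ O (obsE O g hg) = obsE O g hg := by
  rw [functionalAut_obsE, h]
  simp

/-- On `𝔚(O)` the unitary of a functional acts like `e^{iA(c)}` if the functional is the pairing
with `c` on test functions supported in `O`. -/
theorem Ad_expFunctional_eq_Ad_expA {ℓ : VectorTest →+ ℝ} {c : VectorTest} {O : Set R3}
    (h : ∀ g : VectorTest, tsupport g ⊆ O → ℓ g = pairing c g) {a : Op} (ha : a ∈ weylAlgebra O) :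
    Ad (expFunctional ℓ) a = Ad (expA c) a := by
  have hle : weylAlgebra O ≤ StarAlgHom.equalizer (Ad (expFunctional ℓ)) (Ad (expA c)) := by
    refine weylAlgebra_le ?_ (fun f _ => ?_) (fun g hg => ?_)
    · exact isClosed_eq (isometry_Ad _).continuous (isometry_Ad _).continuous
    · change Ad (expFunctional ℓ) (expA f) = Ad (expA c) (expA f)
      rw [Ad_expFunctional_expA, Ad_expA_expA]
    · change Ad (expFunctional ℓ) (expE g) = Ad (expA c) (expE g)
      rw [Ad_expFunctional_expE, Ad_expA_expE, h g hg]
  exact hle ha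

theorem isClosed_setOf_tendsto_Ad {ι : Type*} (l : Filter ι) (U : ι → unitary Op)
    (V : unitary Op) : IsClosed {a : Op | Tendsto (fun i => Ad (U i) a) l (𝓝 (Ad V a))} := by
  refine isClosed_of_closure_subset fun a ha => Metric.tendsto_nhds.2 fun r hr => ?_
  obtain ⟨c, hc, hac⟩ := Metric.mem_closure_iff.1 ha (r / 3) (by positivity)
  filter_upwards [Metric.tendsto_nhds.1 hc (r / 3) (by positivity)] with i hi
  have h1 := (isometry_Ad (U i)).dist_eq a c
  have h2 := (isometry_Ad V).dist_eq a c
  have h3 := dist_triangle4 (Ad (U i) a) (Ad (U i) c) (Ad V c) (Ad V a)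
  rw [dist_comm (Ad V c)] at h3
  linarith

/-- The elements on which `Ad (U i)` converges to `Ad V` in norm. -/
def convergenceAlgebra {ι : Type*} (l : Filter ι) (U : ι → unitary Op) (V : unitary Op) :
    StarSubalgebra ℂ Op where
  carrier := {a : Op | Tendsto (fun i => Ad (U i) a) l (𝓝 (Ad V a))}
  mul_mem' {a c} ha hc := by
    change Tendsto (fun i => Ad (U i) (a * c)) l (𝓝 (Ad V (a * c)))
    simp only [map_mul]
    exact Tendsto.mul ha hc
  add_mem' {a c} ha hc := by
    change Tendsto (fun i => Ad (U i) (a + c)) l (𝓝 (Ad V (a + c)))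
    simp only [map_add]
    exact Tendsto.add ha hc
  algebraMap_mem' z := by
    change Tendsto (fun i => Ad (U i) (algebraMap ℂ Op z)) l (𝓝 (Ad V (algebraMap ℂ Op z)))
    simp only [AlgHomClass.commutes]
    exact tendsto_const_nhds
  star_mem' {a} ha := by
    change Tendsto (fun i => Ad (U i) (star a)) l (𝓝 (Ad V (star a)))
    simp only [map_star]
    exact Tendsto.star ha

theorem tendsto_Ad_expA {ι : Type*} {l : Filter ι} {b : ι → VectorTest} {ℓ : VectorTest →+ ℝ}
    (h : ∀ g, Tendsto (fun i => pairing (b i) g) l (𝓝 (ℓ g))) {O : Set R3} {a : Op}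
    (ha : a ∈ weylAlgebra O) :
    Tendsto (fun i => Ad (expA (b i)) a) l (𝓝 (Ad (expFunctional ℓ) a)) := by
  have hle : weylAlgebra O ≤ convergenceAlgebra l (fun i => expA (b i)) (expFunctional ℓ) := by
    refine weylAlgebra_le (isClosed_setOf_tendsto_Ad _ _ _) (fun f _ => ?_) (fun g _ => ?_)
    · change Tendsto (fun i => Ad (expA (b i)) (expA f)) l (𝓝 (Ad (expFunctional ℓ) (expA f)))
      simp only [Ad_expA_expA, Ad_expFunctional_expA]
      exact tendsto_const_nhds
    · change Tendsto (fun i => Ad (expA (b i)) (expE g)) l (𝓝 (Ad (expFunctional ℓ) (expE g)))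
      simp only [Ad_expA_expE, Ad_expFunctional_expE]
      refine Tendsto.smul_const ?_ _
      exact (Complex.continuous_exp.comp
        (continuous_const.mul Complex.continuous_ofReal)).continuousAt.tendsto.comp (h g)
  exact hle ha

/-! ### Smooth dependence of integrals on parameters -/

section ParametricIntegral

universe u

variable {E : Type u} [NormedAddCommGroup E] [NormedSpace ℝ E] [FiniteDimensional ℝ E]

theorem hasFDerivAt_intervalIntegral_of_contDiff {G : Type*} [NormedAddCommGroup G]
    [NormedSpace ℝ G] {F : ℝ × E → G} (hF : ContDiff ℝ 1 F) (a b : ℝ) (x : E) :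
    HasFDerivAt (fun x => ∫ u in a..b, F (u, x))
      (∫ u in a..b, (fderiv ℝ F (u, x)).comp (ContinuousLinearMap.inr ℝ ℝ E)) x := by
  have : ProperSpace E := FiniteDimensional.proper ℝ E
  have hF' : Continuous fun p : ℝ × E => (fderiv ℝ F p).comp (ContinuousLinearMap.inr ℝ ℝ E) :=
    (hF.continuous_fderiv one_ne_zero).clm_comp continuous_const
  obtain ⟨C, hC⟩ := (isCompact_uIcc.prod (isCompact_closedBall x 1)).exists_bound_of_continuousOn
    (f := fun p : ℝ × E => (fderiv ℝ F p).comp (ContinuousLinearMap.inr ℝ ℝ E))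
    (s := uIcc a b ×ˢ Metric.closedBall x 1) hF'.continuousOn
  refine intervalIntegral.hasFDerivAt_integral_of_dominated_of_fderiv_le
    (F := fun x u => F (u, x))
    (F' := fun x u => (fderiv ℝ F (u, x)).comp (ContinuousLinearMap.inr ℝ ℝ E))
    (bound := fun _ => C) (Metric.closedBall_mem_nhds x one_pos) ?_ ?_ ?_ ?_ ?_ ?_
  · exact .of_forall fun y => (hF.continuous.comp (.prodMk_left y)).aestronglyMeasurable
  · exact (hF.continuous.comp (.prodMk_left x)).intervalIntegrable a b
  · exact (hF'.comp (.prodMk_left x)).aestronglyMeasurable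
  · exact .of_forall fun u hu y hy => hC (u, y) ⟨uIoc_subset_uIcc hu, hy⟩
  · exact intervalIntegrable_const
  · exact .of_forall fun u _ y _ =>
      ((hF.differentiable one_ne_zero).differentiableAt.hasFDerivAt).comp y
        (hasFDerivAt_prodMk_right u y)

theorem contDiff_intervalIntegral_of_contDiff {G : Type u} [NormedAddCommGroup G]
    [NormedSpace ℝ G] {F : ℝ × E → G} (hF : ContDiff ℝ ∞ F) (a b : ℝ) :
    ContDiff ℝ ∞ fun x => ∫ u in a..b, F (u, x) := by
  refine contDiff_infty.2 fun n => ?_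
  induction n generalizing G with
  | zero =>
    refine contDiff_zero.2 (continuous_iff_continuousAt.2 fun x => ?_)
    exact (hasFDerivAt_intervalIntegral_of_contDiff (hF.of_le (by simp)) a b x).continuousAt
  | succ n ih =>
    have h := hasFDerivAt_intervalIntegral_of_contDiff (hF.of_le (m := 1) (by simp)) a b
    rw [Nat.cast_succ]
    refine (contDiff_succ_iff_fderiv (n := (n : WithTop ℕ∞))).2
      ⟨fun x => (h x).differentiableAt, by simp, ?_⟩
    rw [funext fun x => (h x).fderiv]
    exact ih (F := fun p => (fderiv ℝ F p).comp (ContinuousLinearMap.inr ℝ ℝ E))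
      ((hF.fderiv_right (m := ∞) le_rfl).clm_comp contDiff_const)

end ParametricIntegral

/-! ### Pullbacks of flux densities -/

/-- The vector product as a continuous bilinear map. -/
def crossCLM : R3 →L[ℝ] R3 →L[ℝ] R3 :=
  LinearMap.toContinuousBilinearMap
    ((crossProduct (R := ℝ)).compl₁₂ (WithLp.linearEquiv 2 ℝ (Fin 3 → ℝ)).toLinearMap
      (WithLp.linearEquiv 2 ℝ (Fin 3 → ℝ)).toLinearMap |>.compr₂
        (WithLp.linearEquiv 2 ℝ (Fin 3 → ℝ)).symm.toLinearMap)

theorem crossCLM_apply (a b : R3) : crossCLM a b = cross a b := rfl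

theorem inner_cross (a b c : R3) : inner ℝ a (cross b c) =
    a 0 * (b 1 * c 2 - b 2 * c 1) + a 1 * (b 2 * c 0 - b 0 * c 2) +
      a 2 * (b 0 * c 1 - b 1 * c 0) := by
  simp [cross, cross_apply, PiLp.inner_apply, Fin.sum_univ_three]
  ring

/-- The divergence of a vector field. -/
def divFun (B : R3 → R3) (x : R3) : ℝ := ∑ i, partialDeriv B i i x

theorem clm_apply_eq_sum {F : Type*} [NormedAddCommGroup F] [NormedSpace ℝ F] (L : R3 →L[ℝ] F)
    (a : R3) : L a = ∑ j, a j • L (EuclideanSpace.single j 1) := by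
  have h : a = ∑ j, a j • EuclideanSpace.single j (1 : ℝ) := by
    ext k
    simp [Fin.sum_univ_three]
    fin_cases k <;> simp
  conv_lhs => rw [h, map_sum]
  simp

theorem clm_apply_coord (L : R3 →L[ℝ] R3) (a : R3) (i : Fin 3) :
    L a i = ∑ j, a j * L (EuclideanSpace.single j 1) i := by
  conv_lhs => rw [clm_apply_eq_sum L a]
  simp

section Pullback

variable {E : Type*} [NormedAddCommGroup E] [NormedSpace ℝ E]

/-- The pullback `B(G(x)) · (∂_v G(x) × ∂_w G(x))` of the flux density of `B` along `G`. -/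
def pullback (B : R3 → R3) (G : E → R3) (v w x : E) : ℝ :=
  inner ℝ (B (G x)) (cross (fderiv ℝ G x v) (fderiv ℝ G x w))

theorem contDiff_pullback {B : R3 → R3} {G : E → R3} (hB : ContDiff ℝ ∞ B) (hG : ContDiff ℝ ∞ G)
    (v w : E) : ContDiff ℝ ∞ (pullback B G v w) := by
  have hG' : ContDiff ℝ ∞ (fderiv ℝ G) := hG.fderiv_right (m := ∞) le_rfl
  exact (hB.comp hG).inner ℝ
    ((crossCLM.contDiff.comp (hG'.clm_apply contDiff_const)).clm_apply
      (hG'.clm_apply contDiff_const))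

theorem fderiv_pullback_apply {B : R3 → R3} {G : E → R3} (hB : ContDiff ℝ ∞ B)
    (hG : ContDiff ℝ ∞ G) (v w x u : E) :
    fderiv ℝ (pullback B G v w) x u =
      inner ℝ (fderiv ℝ B (G x) (fderiv ℝ G x u)) (cross (fderiv ℝ G x v) (fderiv ℝ G x w)) +
      inner ℝ (B (G x)) (cross (fderiv ℝ (fderiv ℝ G) x u v) (fderiv ℝ G x w)) +
      inner ℝ (B (G x)) (cross (fderiv ℝ G x v) (fderiv ℝ (fderiv ℝ G) x u w)) := by
  have hG' : ContDiff ℝ ∞ (fderiv ℝ G) := hG.fderiv_right (m := ∞) le_rfl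
  have h1 : HasFDerivAt (fun y => B (G y)) ((fderiv ℝ B (G x)).comp (fderiv ℝ G x)) x :=
    ((hB.differentiable (by simp)) (G x)).hasFDerivAt.comp x
      ((hG.differentiable (by simp)) x).hasFDerivAt
  have h2 (v : E) : HasFDerivAt (fun y => fderiv ℝ G y v)
      ((fderiv ℝ (fderiv ℝ G) x).flip v) x := by
    simpa using ((hG'.differentiable (by simp)) x).hasFDerivAt.clm_apply (hasFDerivAt_const v x)
  have h := h1.inner ℝ (crossCLM.hasFDerivAt_of_bilinear (h2 v) (h2 w))
  rw [show pullback B G v w = fun t => inner ℝ (B (G t))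
    (crossCLM (fderiv ℝ G t v) (fderiv ℝ G t w)) from rfl, h.fderiv]
  simp only [ContinuousLinearMap.comp_apply, ContinuousLinearMap.prod_apply, fderivInnerCLM_apply,
    _root_.add_apply, ContinuousLinearMap.precompR_apply, ContinuousLinearMap.compL_apply,
    ContinuousLinearMap.precompL_apply, ContinuousLinearMap.flip_apply, crossCLM_apply,
    inner_add_right]
  ring

/-- The exterior derivative of a pulled back flux density is the pulled back divergence. -/
theorem fderiv_pullback_cyclic {B : R3 → R3} {G : E → R3} (hB : ContDiff ℝ ∞ B)
    (hG : ContDiff ℝ ∞ G) (u v w x : E) :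
    fderiv ℝ (pullback B G v w) x u + fderiv ℝ (pullback B G w u) x v +
      fderiv ℝ (pullback B G u v) x w =
    divFun B (G x) *
      inner ℝ (fderiv ℝ G x u) (cross (fderiv ℝ G x v) (fderiv ℝ G x w)) := by
  have hs : IsSymmSndFDerivAt ℝ G x := hG.contDiffAt.isSymmSndFDerivAt
    (by simpa using (ENat.LEInfty.out : (2 : WithTop ℕ∞) ≤ ∞))
  rw [fderiv_pullback_apply hB hG, fderiv_pullback_apply hB hG, fderiv_pullback_apply hB hG,
    hs.eq v u, hs.eq w u, hs.eq w v]
  have hc (a : E) (i : Fin 3) := clm_apply_coord (fderiv ℝ B (G x)) (fderiv ℝ G x a) i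
  simp only [inner_cross, hc, divFun, partialDeriv, Fin.sum_univ_three]
  ring

end Pullback

/-! ### Iterated integrals of continuous functions with compact support in one variable -/

theorem integrable_uncurry_of_compact {f : ℝ → R3 → ℝ} (hf : Continuous f.uncurry) {K : Set R3}
    (hK : IsCompact K) (h0 : ∀ u, ∀ x ∉ K, f u x = 0) (a b : ℝ) :
    Integrable f.uncurry ((volume.restrict (uIoc a b)).prod volume) := by
  have h1 : IntegrableOn f.uncurry (uIcc a b ×ˢ K)
      ((volume : Measure ℝ).prod (volume : Measure R3)) :=
    hf.continuousOn.integrableOn_compact (isCompact_uIcc.prod hK)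
  have h2 : IntegrableOn f.uncurry (uIoc a b ×ˢ univ)
      ((volume : Measure ℝ).prod (volume : Measure R3)) := by
    refine h1.of_forall_sdiff_eq_zero (measurableSet_uIoc.prod .univ) fun p hp => h0 _ _ fun hK => ?_
    exact hp.2 ⟨uIoc_subset_uIcc hp.1.1, hK⟩
  rwa [IntegrableOn, ← Measure.prod_restrict, Measure.restrict_univ] at h2

theorem intervalIntegral_integral_swap_of_compact {f : ℝ → R3 → ℝ} (hf : Continuous f.uncurry)
    {K : Set R3} (hK : IsCompact K) (h0 : ∀ u, ∀ x ∉ K, f u x = 0) (a b : ℝ) :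
    ∫ u in a..b, ∫ x, f u x = ∫ x, ∫ u in a..b, f u x :=
  intervalIntegral_integral_swap (integrable_uncurry_of_compact hf hK h0 a b)

theorem continuous_integral_of_compact {f : ℝ → R3 → ℝ} (hf : Continuous f.uncurry)
    {K : Set R3} (hK : IsCompact K) (h0 : ∀ u, ∀ x ∉ K, f u x = 0) :
    Continuous fun u => ∫ x, f u x := by
  have h : (fun u => ∫ x, f u x) = fun u => ∫ x in K, f u x :=
    funext fun u => (setIntegral_eq_integral_of_forall_compl_eq_zero (h0 u)).symm
  rw [h]
  exact continuous_parametric_integral_of_continuous hf hK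

/-! ### The flux through a bundle of neighbouring paths -/

/-- The path `γ` on `[0,1]`, continued by constants. -/
def clampPath (γ : ℝ → R3) (u : ℝ) : R3 := γ (projIcc 0 1 zero_le_one u)

/-- The velocity of `γ` on `[0,1]`, continued by constants. -/
def clampVel (γ : ℝ → R3) (u : ℝ) : R3 :=
  derivWithin γ (Icc 0 1) (projIcc 0 1 zero_le_one u)

theorem clampPath_of_mem (γ : ℝ → R3) {u : ℝ} (hu : u ∈ Icc (0 : ℝ) 1) : clampPath γ u = γ u := by
  rw [clampPath, projIcc_of_mem _ hu]

theorem nbrPath_eq (γ : ℝ → R3) {u : ℝ} (hu : u ∈ Icc (0 : ℝ) 1) (y : R3) :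
    nbrPath γ y u = clampPath γ u + (u * (1 - u)) • y := by
  rw [nbrPath, clampPath_of_mem γ hu]

theorem continuous_clampPath {γ : ℝ → R3} (hγ : ContDiffOn ℝ ∞ γ (Icc 0 1)) :
    Continuous (clampPath γ) :=
  hγ.continuousOn.comp_continuous (continuous_subtype_val.comp continuous_projIcc)
    fun u => (projIcc 0 1 zero_le_one u).2

theorem continuous_clampVel {γ : ℝ → R3} (hγ : ContDiffOn ℝ ∞ γ (Icc 0 1)) :
    Continuous (clampVel γ) :=
  (hγ.continuousOn_derivWithin (uniqueDiffOn_Icc zero_lt_one) (by simp)).comp_continuous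
    (continuous_subtype_val.comp continuous_projIcc) fun u => (projIcc 0 1 zero_le_one u).2

theorem hasDerivAt_nbrPath {γ : ℝ → R3} (hγ : ContDiffOn ℝ ∞ γ (Icc 0 1)) {u : ℝ}
    (hu : u ∈ Ioo (0 : ℝ) 1) (y : R3) :
    HasDerivAt (nbrPath γ y) (clampVel γ u + (1 - 2 * u) • y) u := by
  have h1 : HasDerivAt γ (clampVel γ u) u := by
    rw [clampVel, projIcc_of_mem _ (Ioo_subset_Icc_self hu)]
    exact ((hγ.differentiableOn (by simp)) u (Ioo_subset_Icc_self hu)).hasDerivWithinAt.hasDerivAt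
      (Icc_mem_nhds hu.1 hu.2)
  have h2 : HasDerivAt (fun u : ℝ => (u * (1 - u)) • y) ((1 - 2 * u) • y) u := by
    have h : HasDerivAt (fun u : ℝ => u * (1 - u)) (1 * (1 - u) + u * (-1)) u :=
      (hasDerivAt_id u).mul ((hasDerivAt_id u).const_sub 1)
    rw [show 1 * (1 - u) + u * (-1) = 1 - 2 * u by ring] at h
    exact h.smul_const y
  exact h1.add h2

/-- The integrand `γ_y'(u) · g(γ_y(u))` weighted by `s(y)`. -/
def fluxDensity (γ : ℝ → R3) (s : R3 → ℝ) (g : R3 → R3) (u : ℝ) (y : R3) : ℝ :=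
  s y * inner ℝ (clampVel γ u + (1 - 2 * u) • y) (g (clampPath γ u + (u * (1 - u)) • y))

/-- The function `u ↦ ∫ s(y) γ_y'(u) · g(γ_y(u)) dy`. -/
def flux (γ : ℝ → R3) (s : R3 → ℝ) (g : R3 → R3) (u : ℝ) : ℝ := ∫ y, fluxDensity γ s g u y

theorem continuous_fluxDensity {γ : ℝ → R3} (hγ : ContDiffOn ℝ ∞ γ (Icc 0 1)) {s : R3 → ℝ}
    (hs : Continuous s) {g : R3 → R3} (hg : Continuous g) :
    Continuous (fluxDensity γ s g).uncurry := by
  have h1 := continuous_clampPath hγ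
  have h2 := continuous_clampVel hγ
  simp only [Function.uncurry_def, fluxDensity]
  fun_prop

theorem fluxDensity_eq_zero (γ : ℝ → R3) (s : R3 → ℝ) (g : R3 → R3) (u : ℝ) (y : R3)
    (hy : y ∉ tsupport s) : fluxDensity γ s g u y = 0 := by
  rw [fluxDensity, image_eq_zero_of_notMem_tsupport hy, zero_mul]

theorem continuous_flux {γ : ℝ → R3} (hγ : ContDiffOn ℝ ∞ γ (Icc 0 1)) (s : ScalarTest)
    (g : VectorTest) : Continuous (flux γ s g) :=
  continuous_integral_of_compact (continuous_fluxDensity hγ s.continuous g.continuous)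
    s.hasCompactSupport (fluxDensity_eq_zero γ s g)

theorem integral_inner_bridgeDensity {γ : ℝ → R3} (hγ : ContDiffOn ℝ ∞ γ (Icc 0 1))
    (s : R3 → ℝ) (g : R3 → R3) {u : ℝ} (hu : u ∈ Ioo (0 : ℝ) 1) :
    ∫ x, inner ℝ (bridgeDensity γ s u x) (g x) = flux γ s g u := by
  rw [integral_bridgeDensity γ s hu g, flux]
  refine integral_congr_ae (.of_forall fun y => ?_)
  simp only [fluxDensity, (hasDerivAt_nbrPath hγ hu y).deriv,
    nbrPath_eq γ (Ioo_subset_Icc_self hu)]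

/-- The flux of a gradient is the difference of the values at the end points. -/
theorem integral_flux_grad {γ : ℝ → R3} (hγ : ContDiffOn ℝ ∞ γ (Icc 0 1)) (s s' : ScalarTest)
    {a b : ℝ} (ha : 0 ≤ a) (hab : a ≤ b) (hb : b ≤ 1) :
    ∫ u in a..b, flux γ s (grad s') u =
      ∫ y, s y * (s' (nbrPath γ y b) - s' (nbrPath γ y a)) := by
  have hc := continuous_fluxDensity hγ s.continuous (grad s').continuous
  simp only [flux]
  rw [intervalIntegral_integral_swap_of_compact hc s.hasCompactSupport
    (fluxDensity_eq_zero γ s (grad s'))]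
  refine integral_congr_ae (.of_forall fun y => ?_)
  have hsub : Icc a b ⊆ Icc (0 : ℝ) 1 := Icc_subset_Icc ha hb
  change ∫ u in a..b, fluxDensity γ s (grad s') u y = s y * (s' (nbrPath γ y b) - s' (nbrPath γ y a))
  rw [mul_sub]
  refine intervalIntegral.integral_eq_sub_of_hasDerivAt_of_le
    (f := fun u => s y * s' (nbrPath γ y u)) hab ?_ (fun u hu => ?_)
    ((hc.comp (.prodMk_left y)).intervalIntegrable a b)
  · have h1 := continuous_clampPath hγ
    have h2 : Continuous fun u => s y * s' (clampPath γ u + (u * (1 - u)) • y) := by fun_prop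
    exact h2.continuousOn.congr fun u hu => by simp only [nbrPath_eq γ (hsub hu)]
  · have hu' : u ∈ Ioo (0 : ℝ) 1 := Ioo_subset_Ioo ha hb hu
    have hd := (s'.contDiff.differentiable (by simp)) (nbrPath γ y u)
    have h := (hd.hasFDerivAt.comp_hasDerivAt u (hasDerivAt_nbrPath hγ hu' y)).const_mul (s y)
    refine h.congr_deriv ?_
    rw [fluxDensity, ← nbrPath_eq γ (Ioo_subset_Icc_self hu'), real_inner_comm]
    change _ = s y * inner ℝ (gradient s' _) _
    rw [gradient, InnerProductSpace.toDual_symm_apply]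

/-! ### The functions `b_ε` -/

/-- On `[ε, 1 - ε]` the functions `a_u(x)` depend smoothly on `(u, x)`. -/
theorem exists_contDiff_eq_bridgeDensity {γ : ℝ → R3} (hγ : ContDiffOn ℝ ∞ γ (Icc 0 1))
    (s : ScalarTest) {ε : ℝ} (hε : ε ∈ Ioo (0 : ℝ) (1 / 2)) :
    ∃ F : ℝ × R3 → R3, ContDiff ℝ ∞ F ∧
      ∀ u ∈ Icc ε (1 - ε), ∀ x, F (u, x) = bridgeDensity γ s u x := by
  let χ : ContDiffBump (1 / 2 : ℝ) :=
    ⟨1 / 2 - ε, 1 / 2 - ε / 2, by linarith [hε.2], by linarith [hε.1]⟩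
  have hχ1 : ∀ u ∈ Icc ε (1 - ε), χ u = 1 := fun u hu => by
    refine χ.one_of_mem_closedBall ?_
    rw [Metric.mem_closedBall, Real.dist_eq, abs_le]
    constructor <;> simp only [χ] <;> linarith [hu.1, hu.2]
  have hχ0 : tsupport χ ⊆ Ioo 0 1 := fun u hu => by
    rw [χ.tsupport_eq, Metric.mem_closedBall, Real.dist_eq, abs_le] at hu
    simp only [χ] at hu
    constructor <;> linarith [hε.1, hu.1, hu.2]
  have key {G : Type} [NormedAddCommGroup G] [NormedSpace ℝ G] {f : ℝ → G}
      (hf : ContDiffOn ℝ ∞ f (Ioo 0 1)) : ContDiff ℝ ∞ fun u => χ u • f u := by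
    refine contDiff_iff_contDiffAt.2 fun u => ?_
    by_cases hu : u ∈ tsupport χ
    · exact χ.contDiff.contDiffAt.smul (hf.contDiffAt (isOpen_Ioo.mem_nhds (hχ0 hu)))
    · refine (contDiffAt_const (c := (0 : G))).congr_of_eventuallyEq ?_
      filter_upwards [(isClosed_tsupport χ).isOpen_compl.mem_nhds hu] with t ht
      rw [image_eq_zero_of_notMem_tsupport ht, zero_smul]
  have hγ' : ContDiffOn ℝ ∞ γ (Ioo 0 1) := hγ.mono Ioo_subset_Icc_self
  have h1 := key hγ'
  have h2 := key (hγ'.deriv_of_isOpen isOpen_Ioo (m := ∞) le_rfl)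
  have h3 : ContDiff ℝ ∞ fun u : ℝ => χ u • (u * (1 - u))⁻¹ := by
    refine key (ContDiffOn.inv (by fun_prop) fun u hu => ?_)
    exact (mul_pos hu.1 (sub_pos.2 hu.2)).ne'
  set c := fun u => χ u • γ u with hc
  set v := fun u => χ u • deriv γ u with hv
  set w := fun u : ℝ => χ u • (u * (1 - u))⁻¹ with hw
  refine ⟨fun p => (w p.1 ^ 3 * s (w p.1 • (p.2 - c p.1))) •
    (v p.1 + (1 - 2 * p.1) • (w p.1 • (p.2 - c p.1))), ?_, fun u hu x => ?_⟩
  · have hw' : ContDiff ℝ ∞ fun p : ℝ × R3 => w p.1 := h3.comp contDiff_fst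
    have hy : ContDiff ℝ ∞ fun p : ℝ × R3 => w p.1 • (p.2 - c p.1) :=
      hw'.smul (contDiff_snd.sub (h1.comp contDiff_fst))
    exact ((hw'.pow 3).mul (s.contDiff.comp hy)).smul ((h2.comp contDiff_fst).add
      ((contDiff_const.sub (contDiff_const.mul contDiff_fst)).smul hy))
  · have hu' : u ∈ Ioo (0 : ℝ) 1 := ⟨hε.1.trans_le hu.1, by linarith [hε.1, hu.2]⟩
    have hd := hasDerivAt_nbrPath hγ hu' ((u * (1 - u))⁻¹ • (x - γ u))
    have hd' : deriv γ u = clampVel γ u := by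
      have := (hasDerivAt_nbrPath hγ hu' 0).deriv
      rw [show nbrPath γ 0 = γ from funext fun t => by simp [nbrPath]] at this
      simpa using this
    simp only [bridgeDensity, hd.deriv, hc, hv, hw, hχ1 u hu, one_smul, inv_pow, hd']

theorem contDiff_bridgeFun {γ : ℝ → R3} (hγ : ContDiffOn ℝ ∞ γ (Icc 0 1))
    (s : ScalarTest) {ε : ℝ} (hε : ε ∈ Ioo (0 : ℝ) (1 / 2)) :
    ContDiff ℝ ∞ (bridgeFun γ s ε) := by
  obtain ⟨F, hF, hFe⟩ := exists_contDiff_eq_bridgeDensity hγ s hε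
  have h : bridgeFun γ s ε = fun x => ∫ u in ε..(1 - ε), F (u, x) := by
    refine funext fun x => intervalIntegral.integral_congr fun u hu => ?_
    rw [uIcc_of_le (by linarith [hε.2])] at hu
    exact (hFe u hu x).symm
  rw [h]
  exact contDiff_intervalIntegral_of_contDiff hF ε (1 - ε)

theorem integral_inner_bridgeFun {γ : ℝ → R3} (hγ : ContDiffOn ℝ ∞ γ (Icc 0 1))
    (s : ScalarTest) (g : VectorTest) {ε : ℝ} (hε : ε ∈ Ioo (0 : ℝ) (1 / 2)) :
    ∫ x, inner ℝ (bridgeFun γ s ε x) (g x) = ∫ u in ε..(1 - ε), flux γ s g u := by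
  obtain ⟨F, hF, hFe⟩ := exists_contDiff_eq_bridgeDensity hγ s hε
  have hle : ε ≤ 1 - ε := by linarith [hε.2]
  have hFc := hF.continuous
  have h1 : ∫ u in ε..(1 - ε), flux γ s g u =
      ∫ u in ε..(1 - ε), ∫ x, inner ℝ (F (u, x)) (g x) := by
    refine intervalIntegral.integral_congr fun u hu => ?_
    rw [uIcc_of_le hle] at hu
    simp only [hFe u hu]
    exact (integral_inner_bridgeDensity hγ s g
      ⟨hε.1.trans_le hu.1, by linarith [hε.1, hu.2]⟩).symm
  rw [h1, intervalIntegral_integral_swap_of_compact (f := fun u x => inner ℝ (F (u, x)) (g x))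
    (by simp only [Function.uncurry_def]; fun_prop) g.hasCompactSupport
    (fun u x hx => by simp [image_eq_zero_of_notMem_tsupport hx])]
  refine integral_congr_ae (.of_forall fun x => ?_)
  have h2 : bridgeFun γ s ε x = ∫ u in ε..(1 - ε), F (u, x) := by
    refine intervalIntegral.integral_congr fun u hu => ?_
    rw [uIcc_of_le hle] at hu
    exact (hFe u hu x).symm
  have hi : IntervalIntegrable (fun u => F (u, x)) volume ε (1 - ε) :=
    (hFc.comp (.prodMk_left x)).intervalIntegrable _ _
  simp only [h2]
  rw [real_inner_comm, ← innerSL_apply_apply ℝ, ← ContinuousLinearMap.intervalIntegral_comp_comm _ hi]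
  exact intervalIntegral.integral_congr fun u _ => by
    simp only [innerSL_apply_apply, real_inner_comm]

/-- The points of the neighbouring paths on `[ε, 1 - ε]` that carry `b_ε`. -/
def bridgeSupport (γ : ℝ → R3) (s : R3 → ℝ) (ε : ℝ) : Set R3 :=
  (fun p : ℝ × R3 => nbrPath γ p.2 p.1) '' (Icc ε (1 - ε) ×ˢ tsupport s)

theorem isCompact_bridgeSupport {γ : ℝ → R3} (hγ : ContDiffOn ℝ ∞ γ (Icc 0 1))
    (s : ScalarTest) {ε : ℝ} (hε : 0 < ε) : IsCompact (bridgeSupport γ s ε) := by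
  refine (isCompact_Icc.prod s.hasCompactSupport).image_of_continuousOn ?_
  have h1 := continuous_clampPath hγ
  have h2 : Continuous fun p : ℝ × R3 => clampPath γ p.1 + (p.1 * (1 - p.1)) • p.2 := by fun_prop
  exact h2.continuousOn.congr fun p hp =>
    nbrPath_eq γ ⟨hε.le.trans hp.1.1, by linarith [hp.1.2]⟩ p.2

theorem tsupport_bridgeFun_subset {γ : ℝ → R3} (hγ : ContDiffOn ℝ ∞ γ (Icc 0 1))
    (s : ScalarTest) {ε : ℝ} (hε : ε ∈ Ioo (0 : ℝ) (1 / 2)) :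
    tsupport (bridgeFun γ s ε) ⊆ bridgeSupport γ s ε := by
  refine closure_minimal (fun x hx => ?_) (isCompact_bridgeSupport hγ s hε.1).isClosed
  by_contra hxs
  refine hx (intervalIntegral.integral_zero_ae (.of_forall fun u hu => ?_))
  rw [uIoc_of_le (by linarith [hε.2])] at hu
  have hu0 : u * (1 - u) ≠ 0 := (mul_pos (hε.1.trans hu.1) (by linarith [hε.1, hu.2])).ne'
  have h0 : s ((u * (1 - u))⁻¹ • (x - γ u)) = 0 := by
    by_contra h
    refine hxs ⟨(u, (u * (1 - u))⁻¹ • (x - γ u)), ⟨Ioc_subset_Icc_self hu, subset_tsupport _ h⟩, ?_⟩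
    simp only [nbrPath, smul_smul, mul_inv_cancel₀ hu0, one_smul, add_sub_cancel]
  simp only [bridgeDensity, h0, mul_zero, zero_smul]

/-- The neighbouring paths of `γ` do not meet an end point `x` of `γ`. -/
theorem nbrPath_ne_of_le {γ : ℝ → R3} {R : ℝ} {x : R3}
    (hR : ∀ u ∈ Ioo (0 : ℝ) 1, R ≤ u⁻¹ * (1 - u)⁻¹ * ‖γ u - x‖) {y : R3} (hy : ‖y‖ < R) {u : ℝ}
    (hu : u ∈ Ioo (0 : ℝ) 1) : nbrPath γ y u ≠ x := by
  intro h
  have hu0 : 0 < u * (1 - u) := mul_pos hu.1 (sub_pos.2 hu.2)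
  have h1 : γ u - x = -((u * (1 - u)) • y) := by
    rw [← h, nbrPath]
    abel
  have h2 := hR u hu
  rw [h1, norm_neg, norm_smul, Real.norm_of_nonneg hu0.le, ← mul_inv, ← mul_assoc,
    inv_mul_cancel₀ hu0.ne', one_mul] at h2
  exact absurd hy (not_lt.2 h2)

/-! ### The limit of the pairings with `b_ε` -/

theorem flux_add {γ : ℝ → R3} (hγ : ContDiffOn ℝ ∞ γ (Icc 0 1)) (s : ScalarTest)
    (g g' : VectorTest) (u : ℝ) :
    flux γ s (g + g' : VectorTest) u = flux γ s g u + flux γ s g' u := by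
  have hi (g : VectorTest) : Integrable (fluxDensity γ s g u) := by
    have hc : Continuous (fluxDensity γ s g u) :=
      (continuous_fluxDensity hγ s.continuous g.continuous).comp (.prodMk_right u)
    exact hc.integrable_of_hasCompactSupport
      (.intro s.hasCompactSupport fun y hy => fluxDensity_eq_zero γ s g u y hy)
  rw [flux, flux, flux, ← integral_add (hi g) (hi g')]
  refine integral_congr_ae (.of_forall fun y => ?_)
  simp only [fluxDensity, _root_.add_apply, inner_add_right, mul_add]

/-- The functional `g ↦ lim ⟨b_ε, g⟩`. -/
def bridgeFunctional {γ : ℝ → R3} (hγ : ContDiffOn ℝ ∞ γ (Icc 0 1)) (s : ScalarTest) :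
    VectorTest →+ ℝ :=
  AddMonoidHom.mk' (fun g => ∫ u in (0 : ℝ)..1, flux γ s g u) fun g g' => by
    simp only [flux_add hγ]
    exact intervalIntegral.integral_add ((continuous_flux hγ s g).intervalIntegrable _ _)
      ((continuous_flux hγ s g').intervalIntegrable _ _)

theorem bridgeFunctional_apply {γ : ℝ → R3} (hγ : ContDiffOn ℝ ∞ γ (Icc 0 1)) (s : ScalarTest)
    (g : VectorTest) : bridgeFunctional hγ s g = ∫ u in (0 : ℝ)..1, flux γ s g u := rfl

theorem bridgeFunctional_grad {γ : ℝ → R3} (hγ : ContDiffOn ℝ ∞ γ (Icc 0 1)) (s s' : ScalarTest) :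
    bridgeFunctional hγ s (grad s') = (∫ y, s y) * (s' (γ 1) - s' (γ 0)) := by
  rw [bridgeFunctional_apply, integral_flux_grad hγ s s' le_rfl zero_le_one le_rfl,
    ← integral_mul_const]
  simp [nbrPath]

theorem tendsto_integral_flux {γ : ℝ → R3} (hγ : ContDiffOn ℝ ∞ γ (Icc 0 1)) (s : ScalarTest)
    (g : VectorTest) : Tendsto (fun ε : ℝ => ∫ u in ε..(1 - ε), flux γ s g u) (𝓝[>] 0)
      (𝓝 (bridgeFunctional hγ s g)) := by
  have hi (a b : ℝ) : IntervalIntegrable (flux γ s g) volume a b :=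
    (continuous_flux hγ s g).intervalIntegrable a b
  have hp := intervalIntegral.continuous_primitive hi 0
  have hc : Continuous fun ε : ℝ => ∫ u in ε..(1 - ε), flux γ s g u := by
    rw [← funext fun ε => intervalIntegral.integral_interval_sub_left (hi 0 (1 - ε)) (hi 0 ε)]
    exact (hp.comp (continuous_const.sub continuous_id)).sub hp
  have h := (hc.tendsto 0).mono_left (nhdsWithin_le_nhds (s := Ioi 0))
  rwa [sub_zero] at h

/-! ### Localization near the end points -/

theorem exists_nbrPath_mem_ball {γ : ℝ → R3} (hγ : ContDiffOn ℝ ∞ γ (Icc 0 1)) {R r : ℝ}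
    (hr : 0 < r) :
    ∃ ε ∈ Ioo (0 : ℝ) (1 / 2), ∀ u ∈ Icc 0 ε, ∀ y ∈ Metric.ball (0 : R3) R,
      nbrPath γ y u ∈ Metric.ball (γ 0) r ∧ nbrPath γ y (1 - u) ∈ Metric.ball (γ 1) r := by
  have hc := continuous_clampPath hγ
  have h0 : clampPath γ 0 = γ 0 := clampPath_of_mem γ (by simp)
  have h1 : clampPath γ 1 = γ 1 := clampPath_of_mem γ (by simp)
  have e0 : ∀ᶠ u in 𝓝 (0 : ℝ), ‖clampPath γ u - γ 0‖ + |u * (1 - u)| * R < r := by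
    have : Continuous fun u : ℝ => ‖clampPath γ u - γ 0‖ + |u * (1 - u)| * R := by fun_prop
    refine (this.tendsto 0).eventually_lt_const ?_
    simpa [h0] using hr
  have e1 : ∀ᶠ u in 𝓝 (0 : ℝ), ‖clampPath γ (1 - u) - γ 1‖ + |u * (1 - u)| * R < r := by
    have : Continuous fun u : ℝ => ‖clampPath γ (1 - u) - γ 1‖ + |u * (1 - u)| * R := by fun_prop
    refine (this.tendsto 0).eventually_lt_const ?_
    simpa [h1] using hr
  obtain ⟨δ, hδ, h⟩ := Metric.eventually_nhds_iff.1 (e0.and e1)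
  refine ⟨min (δ / 2) (1 / 4), ⟨by positivity, by linarith [min_le_right (δ / 2) (1 / 4 : ℝ)]⟩,
    fun u hu y hy => ?_⟩
  have hu1 : u ≤ 1 / 4 := hu.2.trans (min_le_right _ _)
  have hu' := @h u (by
    rw [Real.dist_eq, sub_zero, abs_of_nonneg hu.1]
    linarith [hu.2.trans (min_le_left _ _)])
  have hy' : ‖(u * (1 - u)) • y‖ ≤ |u * (1 - u)| * R := by
    rw [norm_smul, Real.norm_eq_abs]
    exact mul_le_mul_of_nonneg_left (mem_ball_zero_iff.1 hy).le (abs_nonneg _)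
  constructor
  · rw [nbrPath_eq γ ⟨hu.1, by linarith⟩, mem_ball_iff_norm, add_sub_right_comm]
    exact (norm_add_le _ _).trans_lt (by linarith [hu'.1])
  · rw [nbrPath_eq γ ⟨by linarith, by linarith [hu.1]⟩, mem_ball_iff_norm, add_sub_right_comm,
      sub_sub_cancel, mul_comm]
    exact (norm_add_le _ _).trans_lt (by linarith [hu'.2])

theorem flux_eq_zero {γ : ℝ → R3} {s : R3 → ℝ} {g : R3 → R3} {u : ℝ} (hu : u ∈ Icc (0 : ℝ) 1)
    (h : ∀ y ∈ tsupport s, g (nbrPath γ y u) = 0) : flux γ s g u = 0 := by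
  refine integral_eq_zero_of_ae (.of_forall fun y => ?_)
  by_cases hy : y ∈ tsupport s
  · simp [fluxDensity, ← nbrPath_eq γ hu, h y hy]
  · exact fluxDensity_eq_zero γ s g u y hy

theorem bridgeFunctional_eq_of_forall {γ : ℝ → R3} (hγ : ContDiffOn ℝ ∞ γ (Icc 0 1))
    {s : ScalarTest} {g : VectorTest} {ε : ℝ} (hε : ε ∈ Ioo (0 : ℝ) (1 / 2))
    (h : ∀ u ∈ Icc 0 ε, ∀ y ∈ tsupport s,
      g (nbrPath γ y u) = 0 ∧ g (nbrPath γ y (1 - u)) = 0) :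
    bridgeFunctional hγ s g = ∫ u in ε..(1 - ε), flux γ s g u := by
  have hi (a b : ℝ) : IntervalIntegrable (flux γ s g) volume a b :=
    (continuous_flux hγ s g).intervalIntegrable a b
  rw [bridgeFunctional_apply, ← intervalIntegral.integral_add_adjacent_intervals (hi 0 ε) (hi ε 1),
    ← intervalIntegral.integral_add_adjacent_intervals (hi ε (1 - ε)) (hi (1 - ε) 1)]
  have h1 : ∫ u in (0 : ℝ)..ε, flux γ s g u = 0 := by
    refine intervalIntegral.integral_zero_ae (.of_forall fun u hu => ?_)
    rw [uIoc_of_le hε.1.le] at hu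
    exact flux_eq_zero ⟨hu.1.le, by linarith [hu.2, hε.2]⟩
      fun y hy => (h u (Ioc_subset_Icc_self hu) y hy).1
  have h2 : ∫ u in (1 - ε)..1, flux γ s g u = 0 := by
    refine intervalIntegral.integral_zero_ae (.of_forall fun u hu => ?_)
    rw [uIoc_of_le (by linarith [hε.1])] at hu
    refine flux_eq_zero ⟨by linarith [hu.1, hε.2], hu.2⟩ fun y hy => ?_
    simpa using (h (1 - u) ⟨by linarith [hu.2], by linarith [hu.1]⟩ y hy).2
  rw [h1, h2, zero_add, add_zero]

/-! ### The divergence of `b_ε` -/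

theorem contDiff_divFun {B : R3 → R3} (hB : ContDiff ℝ ∞ B) : ContDiff ℝ ∞ (divFun B) :=
  ContDiff.sum fun i _ => contDiff_partialDeriv hB i i

theorem fderiv_coord {B : R3 → R3} {x : R3} (hB : DifferentiableAt ℝ B x) (i : Fin 3) (v : R3) :
    fderiv ℝ (fun x => B x i) x v = fderiv ℝ B x v i := by
  have h := ((EuclideanSpace.proj i : R3 →L[ℝ] ℝ).hasFDerivAt (x := B x)).comp x hB.hasFDerivAt
  exact congrArg (fun L : R3 →L[ℝ] ℝ => L v) h.fderiv

theorem inner_grad (φ : ScalarTest) (x a : R3) :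
    inner ℝ a (grad φ x) = ∑ i, a i * fderiv ℝ φ x (EuclideanSpace.single i 1) := by
  rw [real_inner_comm]
  change inner ℝ (gradient φ x) a = _
  rw [gradient, InnerProductSpace.toDual_symm_apply, clm_apply_eq_sum]
  rfl

theorem integral_mul_divFun (φ : ScalarTest) {B : R3 → R3} (hB : ContDiff ℝ ∞ B) :
    ∫ x, φ x * divFun B x = -∫ x, inner ℝ (B x) (grad φ x) := by
  have hBi (i : Fin 3) : ContDiff ℝ ∞ fun x => B x i := (contDiff_piLp 2).1 hB i
  have hφ : Continuous (fderiv ℝ φ) := φ.contDiff.continuous_fderiv (by simp)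
  have hint {f : R3 → ℝ} (hf : Continuous f) (h0 : ∀ x ∉ tsupport φ, f x = 0) : Integrable f :=
    hf.integrable_of_hasCompactSupport (.intro φ.hasCompactSupport h0)
  have i1 (i : Fin 3) : Integrable fun x => fderiv ℝ φ x (EuclideanSpace.single i 1) * B x i :=
    hint ((hφ.clm_apply continuous_const).mul (hBi i).continuous)
      fun x hx => by simp [fderiv_of_notMem_tsupport ℝ hx]
  have i2 (i : Fin 3) : Integrable fun x => φ x * partialDeriv B i i x :=
    hint (φ.continuous.mul (contDiff_partialDeriv hB i i).continuous)
      fun x hx => by simp [image_eq_zero_of_notMem_tsupport hx]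
  have i3 (i : Fin 3) : Integrable fun x => φ x * B x i :=
    hint (φ.continuous.mul (hBi i).continuous)
      fun x hx => by simp [image_eq_zero_of_notMem_tsupport hx]
  have hpart (i : Fin 3) (x : R3) : partialDeriv B i i x =
      fderiv ℝ (fun x => B x i) x (EuclideanSpace.single i 1) :=
    (fderiv_coord (hB.differentiable (by simp) x) i _).symm
  have hib (i : Fin 3) : ∫ x, φ x * partialDeriv B i i x =
      -∫ x, fderiv ℝ φ x (EuclideanSpace.single i 1) * B x i := by
    have i2' := i2 i
    simp only [hpart] at i2' ⊢
    exact integral_mul_fderiv_eq_neg_fderiv_mul_of_integrable (i1 i) i2' (i3 i)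
      (fun x _ => φ.contDiff.differentiable (by simp) x)
      (fun x _ => (hBi i).differentiable (by simp) x)
  simp only [divFun, inner_grad, Finset.mul_sum]
  rw [integral_finsetSum _ fun i _ => i2 i, integral_finsetSum _ fun i _ => by
    simpa only [mul_comm] using i1 i, ← Finset.sum_neg_distrib]
  refine Finset.sum_congr rfl fun i _ => ?_
  rw [hib i]
  simp only [mul_comm]

/-- `b_ε` is divergence free away from its two ends. -/
theorem divFun_bridgeFun_eq_zero {γ : ℝ → R3} (hγ : ContDiffOn ℝ ∞ γ (Icc 0 1)) {s : ScalarTest}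
    {ε : ℝ} (hε : ε ∈ Ioo (0 : ℝ) (1 / 2)) {U : Set R3} (hU : IsOpen U)
    (h : ∀ y ∈ tsupport s, nbrPath γ y ε ∉ U ∧ nbrPath γ y (1 - ε) ∉ U) {x : R3} (hx : x ∈ U) :
    divFun (bridgeFun γ s ε) x = 0 := by
  have hb := contDiff_bridgeFun hγ s hε
  have hd := (contDiff_divFun hb).continuous
  have hae : ∀ᵐ x, x ∈ U → divFun (bridgeFun γ s ε) x = 0 := by
    refine hU.ae_eq_zero_of_integral_contDiff_smul_eq_zero
      (hd.locallyIntegrable.locallyIntegrableOn U) fun φ hφ hφc hφU => ?_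
    let φ' : ScalarTest := ⟨φ, hφ, hφc, fun _ _ => trivial⟩
    have h1 := integral_mul_divFun φ' hb
    rw [integral_inner_bridgeFun hγ s (grad φ') hε, integral_flux_grad hγ s φ' hε.1.le
      (by linarith [hε.2]) (by linarith [hε.1])] at h1
    refine h1.trans ?_
    rw [neg_eq_zero]
    refine integral_eq_zero_of_ae (.of_forall fun y => ?_)
    by_cases hy : y ∈ tsupport s
    · have z1 : φ' (nbrPath γ y ε) = 0 :=
        image_eq_zero_of_notMem_tsupport fun hm => (h y hy).1 (hφU hm)
      have z2 : φ' (nbrPath γ y (1 - ε)) = 0 :=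
        image_eq_zero_of_notMem_tsupport fun hm => (h y hy).2 (hφU hm)
      simp [z1, z2]
    · simp [image_eq_zero_of_notMem_tsupport hy]
  exact Measure.eqOn_open_of_ae_eq (g := fun _ => (0 : ℝ))
    ((ae_restrict_iff' hU.measurableSet).2 hae) hU hd.continuousOn continuousOn_const hx

/-! ### Gauss' theorem for parametrized cubes -/

/-- The linear map that inserts `0` at the place `i`. -/
def insertZero (i : Fin 3) : (Fin 2 → ℝ) →L[ℝ] (Fin 3 → ℝ) :=
  ContinuousLinearMap.pi
    (i.insertNth (α := fun _ => (Fin 2 → ℝ) →L[ℝ] ℝ) 0 fun j => ContinuousLinearMap.proj j)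

theorem insertZero_single (i : Fin 3) (j : Fin 2) :
    insertZero i (Pi.single j 1) = Pi.single (i.succAbove j) 1 := by
  ext k
  induction k using Fin.succAboveCases i with
  | x => simp [insertZero, (Fin.succAbove_ne i j).symm]
  | p k => simp [insertZero, Pi.single_apply]

theorem hasFDerivAt_insertNth (i : Fin 3) (a : ℝ) (u : Fin 2 → ℝ) :
    HasFDerivAt (fun u : Fin 2 → ℝ => (i.insertNth a u : Fin 3 → ℝ)) (insertZero i) u := by
  refine hasFDerivAt_pi.2 fun k => ?_
  induction k using Fin.succAboveCases i with
  | x => simpa using hasFDerivAt_const a u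
  | p k => simpa only [Fin.insertNth_apply_succAbove] using hasFDerivAt_apply k u

theorem normal_face {c : (Fin 3 → ℝ) → R3} (hc : ContDiff ℝ ∞ c) (i : Fin 3) (a : ℝ)
    (u : Fin 2 → ℝ) : normal (face c i a) u =
      cross (fderiv ℝ c (i.insertNth a u) (Pi.single (i.succAbove 0) 1))
        (fderiv ℝ c (i.insertNth a u) (Pi.single (i.succAbove 1) 1)) := by
  have h : HasFDerivAt (face c i a) ((fderiv ℝ c (i.insertNth a u)).comp (insertZero i)) u :=
    (hc.differentiable (by simp) _).hasFDerivAt.comp u (hasFDerivAt_insertNth i a u)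
  rw [normal, h.fderiv, ContinuousLinearMap.comp_apply, ContinuousLinearMap.comp_apply,
    insertZero_single, insertZero_single]

theorem inner_normal_face {c : (Fin 3 → ℝ) → R3} (hc : ContDiff ℝ ∞ c) (B : R3 → R3) (i : Fin 3)
    (a : ℝ) (u : Fin 2 → ℝ) : inner ℝ (B (face c i a u)) (normal (face c i a) u) =
      pullback B c (Pi.single (i.succAbove 0) 1) (Pi.single (i.succAbove 1) 1)
        (i.insertNth a u) := by
  rw [normal_face hc]
  rfl

theorem pullback_swap {E : Type*} [NormedAddCommGroup E] [NormedSpace ℝ E] (B : R3 → R3)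
    (G : E → R3) (v w : E) : pullback B G v w = -pullback B G w v := by
  ext x
  simp only [pullback, Pi.neg_apply, inner_cross]
  ring

theorem det_jacobian (c : (Fin 3 → ℝ) → R3) (u : Fin 3 → ℝ) : (jacobian c u).det =
    inner ℝ (fderiv ℝ c u (Pi.single 0 1))
      (cross (fderiv ℝ c u (Pi.single 1 1)) (fderiv ℝ c u (Pi.single 2 1))) := by
  rw [inner_cross, Matrix.det_fin_three]
  simp only [jacobian, Matrix.of_apply]
  ring

/-- Gauss' theorem for a parametrized cube. -/
theorem sum_integral_faces_eq {c : (Fin 3 → ℝ) → R3} (hc : ContDiff ℝ ∞ c) {B : R3 → R3}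
    (hB : ContDiff ℝ ∞ B) :
    ∑ i : Fin 3, (-1 : ℝ) ^ (i : ℕ) *
      ((∫ u in Icc (0 : Fin 2 → ℝ) 1, inner ℝ (B (face c i 1 u)) (normal (face c i 1) u)) -
        ∫ u in Icc (0 : Fin 2 → ℝ) 1, inner ℝ (B (face c i 0 u)) (normal (face c i 0) u)) =
    ∫ u in Icc (0 : Fin 3 → ℝ) 1, divFun B (c u) * (jacobian c u).det := by
  let f : Fin 3 → (Fin 3 → ℝ) → ℝ := fun i u => (-1 : ℝ) ^ (i : ℕ) *
    pullback B c (Pi.single (i.succAbove 0) 1) (Pi.single (i.succAbove 1) 1) u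
  have hf (i : Fin 3) : ContDiff ℝ ∞ (f i) := contDiff_const.mul (contDiff_pullback hB hc _ _)
  have hdiv (u : Fin 3 → ℝ) : ∑ i, fderiv ℝ (f i) u (Pi.single i 1) =
      divFun B (c u) * (jacobian c u).det := by
    have h0 : f 0 = pullback B c (Pi.single 1 1) (Pi.single 2 1) := by
      ext x; simp [f]
    have h1 : f 1 = pullback B c (Pi.single 2 1) (Pi.single 0 1) := by
      rw [pullback_swap]; ext x; simp [f]
    have h2 : f 2 = pullback B c (Pi.single 0 1) (Pi.single 1 1) := by
      ext x; simp [f]; rfl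
    rw [Fin.sum_univ_three, h0, h1, h2, fderiv_pullback_cyclic hB hc, det_jacobian]
  have hdivc : Continuous fun u => ∑ i, fderiv ℝ (f i) u (Pi.single i 1) :=
    continuous_finsetSum _ fun i _ =>
      ((hf i).continuous_fderiv (by simp)).clm_apply continuous_const
  have key := integral_divergence_of_hasFDerivAt_off_countable' (0 : Fin 3 → ℝ) 1
    zero_le_one f (fun i u => fderiv ℝ (f i) u) ∅ countable_empty
    (fun i => (hf i).continuous.continuousOn)
    (fun u _ i => ((hf i).differentiable (by simp) u).hasFDerivAt)
    (hdivc.continuousOn.integrableOn_compact isCompact_Icc)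
  simp only [hdiv] at key
  rw [key]
  refine Finset.sum_congr rfl fun i _ => ?_
  simp only [inner_normal_face hc, mul_sub, f, integral_const_mul, Pi.one_apply, Pi.zero_apply]
  rfl

/-! ### Integration over a region -/

/-- The open unit cube. -/
abbrev openCube : Set (Fin 3 → ℝ) := univ.pi fun _ => Ioo (0 : ℝ) 1

theorem measurableSet_openCube : MeasurableSet openCube :=
  MeasurableSet.univ_pi fun _ => measurableSet_Ioo

theorem openCube_ae_eq_Icc : openCube =ᵐ[volume] Icc (0 : Fin 3 → ℝ) 1 :=
  Measure.univ_pi_Ioo_ae_eq_Icc (f := (0 : Fin 3 → ℝ)) (g := 1)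

theorem openCube_subset_Icc : openCube ⊆ Icc (0 : Fin 3 → ℝ) 1 := fun _ hu =>
  ⟨fun i => (hu i trivial).1.le, fun i => (hu i trivial).2.le⟩

theorem hasFDerivAt_ofLp_comp {c : (Fin 3 → ℝ) → R3} (hc : ContDiff ℝ ∞ c) (u : Fin 3 → ℝ) :
    HasFDerivAt (fun u => (c u).ofLp)
      ((PiLp.continuousLinearEquiv 2 ℝ (fun _ : Fin 3 => ℝ) : R3 →L[ℝ] (Fin 3 → ℝ)).comp
        (fderiv ℝ c u)) u :=
  (PiLp.continuousLinearEquiv 2 ℝ (fun _ : Fin 3 => ℝ)).hasFDerivAt.comp u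
    (hc.differentiable (by simp) u).hasFDerivAt

theorem toLp_preimage_image (c : (Fin 3 → ℝ) → R3) (S : Set (Fin 3 → ℝ)) :
    WithLp.toLp 2 ⁻¹' (c '' S) = (fun u => (c u).ofLp) '' S := by
  ext z
  constructor
  · rintro ⟨u, hu, h⟩
    exact ⟨u, hu, by simp [h]⟩
  · rintro ⟨u, hu, rfl⟩
    exact ⟨u, hu, rfl⟩

theorem measurableEmbedding_toLp :
    MeasurableEmbedding (WithLp.toLp 2 : (Fin 3 → ℝ) → R3) :=
  (MeasurableEquiv.toLp 2 (Fin 3 → ℝ)).measurableEmbedding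

/-- The transformation formula for a parametrized cube. -/
theorem setIntegral_image_openCube {c : (Fin 3 → ℝ) → R3} (hc : ContDiff ℝ ∞ c)
    (hinj : InjOn c openCube) (ho : ∀ u ∈ openCube, 0 ≤ (jacobian c u).det) (ψ : R3 → ℝ) :
    ∫ u in Icc (0 : Fin 3 → ℝ) 1, ψ (c u) * (jacobian c u).det = ∫ z in c '' openCube, ψ z := by
  rw [← (PiLp.volume_preserving_toLp (Fin 3)).setIntegral_preimage_emb measurableEmbedding_toLp,
    toLp_preimage_image,
    integral_image_eq_integral_abs_det_fderiv_smul volume measurableSet_openCube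
      (fun u _ => (hasFDerivAt_ofLp_comp hc u).hasFDerivWithinAt)
      (fun u hu v hv h => hinj hu hv (WithLp.ofLp_injective 2 h)),
    ← setIntegral_congr_set openCube_ae_eq_Icc]
  refine setIntegral_congr_fun measurableSet_openCube fun u hu => ?_
  have hdet : ((PiLp.continuousLinearEquiv 2 ℝ (fun _ : Fin 3 => ℝ) : R3 →L[ℝ] (Fin 3 → ℝ)).comp
      (fderiv ℝ c u)).det = (jacobian c u).det := by
    rw [ContinuousLinearMap.det, ← LinearMap.det_toMatrix']
    congr 1
  simp only [hdet, abs_of_nonneg (ho u hu), smul_eq_mul]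
  exact mul_comm _ _

theorem volume_image_sdiff_openCube {c : (Fin 3 → ℝ) → R3} (hc : ContDiff ℝ ∞ c) :
    volume (c '' (Icc 0 1 \ openCube)) = 0 := by
  rw [← (PiLp.volume_preserving_toLp (Fin 3)).measure_preimage_emb measurableEmbedding_toLp,
    toLp_preimage_image]
  exact addHaar_image_eq_zero_of_differentiableOn_of_addHaar_eq_zero volume
    (fun u _ => (hasFDerivAt_ofLp_comp hc u).differentiableAt.differentiableWithinAt)
    (ae_le_set.1 openCube_ae_eq_Icc.symm.le)

theorem Region.isCompact_carrier (τ : Region) : IsCompact τ.carrier :=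
  isCompact_iUnion fun k => isCompact_Icc.image (τ.smooth k).continuous

theorem Region.carrier_ae_eq (τ : Region) :
    (⋃ k, τ.cell k '' openCube : Set R3) =ᵐ[volume] τ.carrier := by
  refine (LE.le.eventuallyLE
    (iUnion_mono fun k => image_mono openCube_subset_Icc)).antisymm (ae_le_set.2 ?_)
  refine measure_mono_null (t := ⋃ k, τ.cell k '' (Icc 0 1 \ openCube)) ?_
    (measure_iUnion_null fun k => volume_image_sdiff_openCube (τ.smooth k))
  rintro z ⟨hz, hz'⟩
  obtain ⟨k, u, hu, rfl⟩ := mem_iUnion.1 hz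
  exact mem_iUnion.2 ⟨k, u, ⟨hu, fun h => hz' (mem_iUnion.2 ⟨k, u, h, rfl⟩)⟩, rfl⟩

theorem Region.setIntegral_carrier (τ : Region) {ψ : R3 → ℝ} (hψ : Continuous ψ) :
    ∑ k, ∫ u in Icc (0 : Fin 3 → ℝ) 1, ψ (τ.cell k u) * (jacobian (τ.cell k) u).det =
      ∫ z in τ.carrier, ψ z := by
  rw [← setIntegral_congr_set τ.carrier_ae_eq, integral_iUnion_fintype
    (fun k => measurableSet_openCube.image_of_continuousOn_injOn
      (τ.smooth k).continuous.continuousOn (τ.injOn k)) τ.disjoint fun k => ?_]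
  · exact Finset.sum_congr rfl fun k _ =>
      setIntegral_image_openCube (τ.smooth k) (τ.injOn k) (τ.orientation k) ψ
  · exact (hψ.continuousOn.integrableOn_compact τ.isCompact_carrier).mono_set
      ((image_mono openCube_subset_Icc).trans (subset_iUnion (fun k => τ.cell k '' Icc 0 1) k))

/-! ### The functions `g_σ` of closed surfaces -/

theorem locallyIntegrable_indicator_carrier (τ : Region) :
    LocallyIntegrable (τ.carrier.indicator fun _ => (1 : ℝ)) (volume : Measure R3) :=
  (locallyIntegrable_const 1).indicator τ.isCompact_carrier.measurableSet

theorem convolution_carrier (τ : Region) (ψ : R3 → ℝ) (x : R3) :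
    convolution (τ.carrier.indicator fun _ => (1 : ℝ)) ψ (ContinuousLinearMap.lsmul ℝ ℝ) volume x =
      ∫ z in τ.carrier, ψ (x - z) := by
  rw [convolution, ← integral_indicator τ.isCompact_carrier.measurableSet]
  refine integral_congr_ae (.of_forall fun z => ?_)
  by_cases hz : z ∈ τ.carrier <;> simp [hz]

/-- The indicator function of a region, smeared with a test function. -/
def smearedIndicator (τ : Region) (s : ScalarTest) : ScalarTest where
  toFun := convolution (τ.carrier.indicator fun _ => (1 : ℝ)) s (ContinuousLinearMap.lsmul ℝ ℝ)
    volume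
  contDiff' := s.hasCompactSupport.contDiff_convolution_right _
    (locallyIntegrable_indicator_carrier τ) s.contDiff
  hasCompactSupport' := HasCompactSupport.convolution _
    (.intro τ.isCompact_carrier fun z hz => by simp [hz]) s.hasCompactSupport
  tsupport_subset' := fun _ _ => trivial

theorem smearedIndicator_apply (τ : Region) (s : ScalarTest) (x : R3) :
    smearedIndicator τ s x = ∫ z in τ.carrier, s (x - z) :=
  convolution_carrier τ s x

theorem grad_apply_coord (s : ScalarTest) (x : R3) (m : Fin 3) :
    grad s x m = fderiv ℝ s x (EuclideanSpace.single m 1) := by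
  have h := inner_grad s x (EuclideanSpace.single m 1)
  rw [EuclideanSpace.inner_single_left] at h
  fin_cases m <;> simpa [Fin.sum_univ_three] using h

theorem grad_smearedIndicator_apply (τ : Region) (s : ScalarTest) (x : R3) (m : Fin 3) :
    grad (smearedIndicator τ s) x m =
      ∫ z in τ.carrier, fderiv ℝ s (x - z) (EuclideanSpace.single m 1) := by
  rw [grad_apply_coord, ← convolution_carrier τ (fun z => fderiv ℝ s z (EuclideanSpace.single m 1))]
  have h := s.hasCompactSupport.hasFDerivAt_convolution_right (ContinuousLinearMap.lsmul ℝ ℝ)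
    (locallyIntegrable_indicator_carrier τ) (s.contDiff.of_le (by simp)) x
  refine (congrArg (fun L : R3 →L[ℝ] ℝ => L (EuclideanSpace.single m 1)) h.fderiv).trans ?_
  exact convolution_precompR_apply _ (locallyIntegrable_indicator_carrier τ)
    (s.hasCompactSupport.fderiv ℝ) (s.contDiff.continuous_fderiv (by simp)) x _

theorem divFun_smul_single {φ : R3 → ℝ} (hφ : ContDiff ℝ ∞ φ) (m : Fin 3) (z : R3) :
    divFun (fun z => φ z • EuclideanSpace.single m (1 : ℝ)) z =
      fderiv ℝ φ z (EuclideanSpace.single m 1) := by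
  have h := (hφ.differentiable (by simp) z).hasFDerivAt.smul_const
    (EuclideanSpace.single m (1 : ℝ))
  simp only [divFun, partialDeriv, h.fderiv]
  simp

theorem fderiv_comp_const_sub (s : ScalarTest) (x z v : R3) :
    fderiv ℝ (fun z => s (x - z)) z v = -fderiv ℝ s (x - z) v := by
  have h := (s.contDiff.differentiable (by simp) (x - z)).hasFDerivAt.comp z
    ((hasFDerivAt_id z).const_sub x)
  refine (congrArg (fun L : R3 →L[ℝ] ℝ => L v) h.fderiv).trans ?_
  simp

theorem contDiff_comp_const_sub (s : ScalarTest) (x : R3) : ContDiff ℝ ∞ fun z => s (x - z) :=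
  s.contDiff.comp (contDiff_const.sub contDiff_id)

theorem contDiff_face {c : (Fin 3 → ℝ) → R3} (hc : ContDiff ℝ ∞ c) (i : Fin 3) (a : ℝ) :
    ContDiff ℝ ∞ (face c i a) := by
  refine hc.comp (contDiff_pi.2 fun k => ?_)
  induction k using Fin.succAboveCases i with
  | x => simpa using contDiff_const
  | p k => simpa using contDiff_apply ℝ ℝ k

theorem continuous_normal {σ : (Fin 2 → ℝ) → R3} (hσ : ContDiff ℝ ∞ σ) : Continuous (normal σ) := by
  have h := hσ.continuous_fderiv (by simp)
  exact (crossCLM.continuous.comp (h.clm_apply continuous_const)).clm_apply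
    (h.clm_apply continuous_const)

theorem patchFun_apply_coord (s : ScalarTest) {σ : (Fin 2 → ℝ) → R3} (hσ : ContDiff ℝ ∞ σ)
    (x : R3) (m : Fin 3) : patchFun s σ x m = ∫ u in Icc (0 : Fin 2 → ℝ) 1,
      inner ℝ (s (x - σ u) • EuclideanSpace.single m (1 : ℝ)) (normal σ u) := by
  have hc : Continuous fun u => s (x - σ u) • normal σ u :=
    (s.continuous.comp (continuous_const.sub hσ.continuous)).smul (continuous_normal hσ)
  have h := (EuclideanSpace.proj m : R3 →L[ℝ] ℝ).integral_comp_comm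
    (hc.continuousOn.integrableOn_compact (μ := volume)
      (isCompact_Icc (a := (0 : Fin 2 → ℝ)) (b := 1)))
  refine h.symm.trans (integral_congr_ae (.of_forall fun u => ?_))
  simp [real_inner_smul_left, EuclideanSpace.inner_single_left]

/-- Gauss' theorem: `g_σ` is minus the gradient of the smeared indicator function. -/
theorem surfaceFun_eq (τ : Region) (s : ScalarTest) (x : R3) :
    τ.surfaceFun s x = -grad (smearedIndicator τ s) x := by
  ext m
  have hφ := contDiff_comp_const_sub s x
  have hB : ContDiff ℝ ∞ fun z => s (x - z) • EuclideanSpace.single m (1 : ℝ) :=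
    hφ.smul contDiff_const
  have hk (k : Fin τ.n) := sum_integral_faces_eq (τ.smooth k) hB
  have h := τ.setIntegral_carrier (contDiff_divFun hB).continuous
  rw [← Finset.sum_congr rfl fun k _ => hk k] at h
  simp only [divFun_smul_single hφ, fderiv_comp_const_sub, integral_neg] at h
  rw [PiLp.neg_apply, grad_smearedIndicator_apply, ← h]
  simp only [Region.surfaceFun, WithLp.ofLp_sum, WithLp.ofLp_smul, WithLp.ofLp_sub,
    Finset.sum_apply, Pi.smul_apply, Pi.sub_apply, smul_eq_mul,
    patchFun_apply_coord s (contDiff_face (τ.smooth _) _ _)]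

theorem smearedIndicator_eq_one {τ : Region} {s : ScalarTest} {δ : ℝ}
    (hs : tsupport s ⊆ Metric.ball 0 δ) (h1 : ∫ x, s x = 1) {x : R3}
    (hx : Metric.ball x δ ⊆ τ.carrier) : smearedIndicator τ s x = 1 := by
  rw [smearedIndicator_apply, setIntegral_eq_integral_of_forall_compl_eq_zero fun z hz => ?_,
    integral_sub_left_eq_self (fun z => s z), h1]
  refine image_eq_zero_of_notMem_tsupport fun h => hz (hx ?_)
  rw [Metric.mem_ball, dist_comm, dist_eq_norm]
  exact mem_ball_zero_iff.1 (hs h)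

theorem smearedIndicator_eq_zero {τ : Region} {s : ScalarTest} {δ : ℝ}
    (hs : tsupport s ⊆ Metric.ball 0 δ) {x : R3}
    (hx : Metric.ball x δ ⊆ τ.carrierᶜ) : smearedIndicator τ s x = 0 := by
  rw [smearedIndicator_apply]
  refine setIntegral_eq_zero_of_forall_eq_zero fun z hz => ?_
  refine image_eq_zero_of_notMem_tsupport fun h => hx ?_ hz
  rw [Metric.mem_ball, dist_comm, dist_eq_norm]
  exact mem_ball_zero_iff.1 (hs h)

/-- Away from its boundary, a region contains with each point of a finite set a ball, or it is
disjoint from a ball. -/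
theorem Region.exists_ball_subset (τ : Region) {X : Set R3} (hX : X.Finite)
    (h : τ.surface ⊆ Xᶜ) : ∃ δ > 0, ∀ x ∈ X,
      (x ∈ τ.carrier → Metric.ball x δ ⊆ τ.carrier) ∧
      (x ∉ τ.carrier → Metric.ball x δ ⊆ τ.carrierᶜ) := by
  have hin : X ∩ τ.carrier ⊆ interior τ.carrier := fun x hx => by
    by_contra hi
    exact h ⟨subset_closure hx.2, hi⟩ hx.1
  obtain ⟨δ₁, h₁, hb₁⟩ := (hX.subset inter_subset_left).isCompact.exists_thickening_subset_open
    isOpen_interior hin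
  obtain ⟨δ₂, h₂, hb₂⟩ := (hX.subset (sdiff_subset (t := τ.carrier))).isCompact
    |>.exists_thickening_subset_open τ.isCompact_carrier.isClosed.isOpen_compl
      (fun x hx => hx.2)
  refine ⟨min δ₁ δ₂, lt_min h₁ h₂, fun x hx => ⟨fun hc => ?_, fun hc => ?_⟩⟩
  · exact (Metric.ball_subset_ball (min_le_left _ _)).trans
      ((Metric.ball_subset_thickening (E := X ∩ τ.carrier) ⟨hx, hc⟩ δ₁).trans
        (hb₁.trans interior_subset))
  · exact (Metric.ball_subset_ball (min_le_right _ _)).trans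
      ((Metric.ball_subset_thickening (E := X \ τ.carrier) ⟨hx, hc⟩ δ₂).trans hb₂)

theorem grad_eq_zero_of_eqOn {s : ScalarTest} {U : Set R3} (hU : IsOpen U) {z : ℝ}
    (h : ∀ x ∈ U, s x = z) {x : R3} (hx : x ∈ U) : grad s x = 0 := by
  have he : (s : R3 → ℝ) =ᶠ[𝓝 x] fun _ => z := by
    filter_upwards [hU.mem_nhds hx] with t ht using h t ht
  change gradient s x = 0
  rw [gradient, he.fderiv_eq]
  simp

theorem exists_surface_test (τ : Region) {X : Set R3} (hX : X.Finite) (h : τ.surface ⊆ Xᶜ) :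
    ∃ δ > 0, ∀ s : ScalarTest, tsupport s ⊆ Metric.ball 0 δ → ∫ x, s x = 1 →
      tsupport (-grad (smearedIndicator τ s) : VectorTest) ⊆ Xᶜ ∧
      ∀ x ∈ X, (x ∈ τ.carrier → smearedIndicator τ s x = 1) ∧
        (x ∉ τ.carrier → smearedIndicator τ s x = 0) := by
  obtain ⟨δ, hδ, hb⟩ := τ.exists_ball_subset hX h
  refine ⟨δ / 2, by positivity, fun s hs h1 => ?_⟩
  have hsub {x z : R3} (hz : z ∈ Metric.ball x (δ / 2)) :
      Metric.ball z (δ / 2) ⊆ Metric.ball x δ :=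
    Metric.ball_subset_ball' (by linarith [Metric.mem_ball.1 hz])
  have hloc (x : R3) (hx : x ∈ X) : ∃ r, (∀ z ∈ Metric.ball x (δ / 2),
      smearedIndicator τ s z = r) ∧ (x ∈ τ.carrier → r = 1) ∧ (x ∉ τ.carrier → r = 0) := by
    by_cases hc : x ∈ τ.carrier
    · exact ⟨1, fun z hz => smearedIndicator_eq_one hs h1 ((hsub hz).trans ((hb x hx).1 hc)),
        fun _ => rfl, fun h => absurd hc h⟩
    · exact ⟨0, fun z hz => smearedIndicator_eq_zero hs ((hsub hz).trans ((hb x hx).2 hc)),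
        fun h => absurd h hc, fun _ => rfl⟩
  constructor
  · intro x hx hxX
    obtain ⟨r, hr, -⟩ := hloc x hxX
    refine notMem_tsupport_iff_eventuallyEq.2 ?_ hx
    filter_upwards [Metric.ball_mem_nhds x (half_pos hδ)] with z hz
    change -grad (smearedIndicator τ s) z = 0
    rw [grad_eq_zero_of_eqOn Metric.isOpen_ball hr hz, neg_zero]
  · intro x hxX
    obtain ⟨r, hr, hr1, hr0⟩ := hloc x hxX
    rw [hr x (Metric.mem_ball_self (half_pos hδ))]
    exact ⟨hr1, hr0⟩

section Homotopy

open scoped Manifold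

/-! ### Vector potentials from homotopies -/

/-- The standard basis vectors of `ℝ³`. -/
abbrev stdVec (i : Fin 3) : R3 := EuclideanSpace.single i 1

/-- The pullback of a flux density along a map of `ℝ³`, as a vector field. -/
def pullbackField (B φ : R3 → R3) (x : R3) : R3 :=
  !₂[pullback B φ (stdVec 1) (stdVec 2) x, pullback B φ (stdVec 2) (stdVec 0) x,
    pullback B φ (stdVec 0) (stdVec 1) x]

theorem pullbackField_id (B : R3 → R3) (x : R3) : pullbackField B (fun x => x) x = B x := by
  ext i
  fin_cases i <;> simp [pullbackField, pullback, inner_cross]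

theorem pullbackField_const (B : R3 → R3) (p x : R3) : pullbackField B (fun _ => p) x = 0 := by
  ext i
  fin_cases i <;> simp [pullbackField, pullback, inner_cross]

/-- The vector potential `αᵢ(x) = ∫₀¹ B(G) · (∂ₜG × ∂ᵢG) dt` of a homotopy `G`. -/
def homotopyPotential (B : R3 → R3) (G : ℝ × R3 → R3) (x : R3) : R3 :=
  WithLp.toLp 2 fun i => ∫ t in (0 : ℝ)..1, pullback B G (1, 0) (0, stdVec i) (t, x)

theorem contDiff_homotopyPotential {B : R3 → R3} (hB : ContDiff ℝ ∞ B) {G : ℝ × R3 → R3}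
    (hG : ContDiff ℝ ∞ G) : ContDiff ℝ ∞ (homotopyPotential B G) :=
  (contDiff_piLp 2).2 fun i =>
    contDiff_intervalIntegral_of_contDiff (contDiff_pullback hB hG (1, 0) (0, stdVec i)) 0 1

theorem partialDeriv_homotopyPotential {B : R3 → R3} (hB : ContDiff ℝ ∞ B) {G : ℝ × R3 → R3}
    (hG : ContDiff ℝ ∞ G) (j i : Fin 3) (x : R3) :
    partialDeriv (homotopyPotential B G) j i x =
      ∫ t in (0 : ℝ)..1, fderiv ℝ (pullback B G (1, 0) (0, stdVec i)) (t, x) (0, stdVec j) := by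
  have hp := contDiff_pullback hB hG (1, 0) (0, stdVec i)
  have hd := hasFDerivAt_intervalIntegral_of_contDiff (hp.of_le (by simp)) 0 1 x
  have hc : Continuous fun t : ℝ => (fderiv ℝ (pullback B G (1, 0) (0, stdVec i)) (t, x)).comp
      (ContinuousLinearMap.inr ℝ ℝ R3) :=
    ((hp.continuous_fderiv (by simp)).comp (.prodMk_left x)).clm_comp continuous_const
  rw [partialDeriv, ← fderiv_coord
    ((contDiff_homotopyPotential hB hG).differentiable (by simp) x) i]
  refine (congrArg (fun L : R3 →L[ℝ] ℝ => L (stdVec j)) hd.fderiv).trans ?_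
  exact ContinuousLinearMap.intervalIntegral_apply (hc.intervalIntegrable 0 1) (stdVec j)

theorem pullback_slice (B : R3 → R3) {G : ℝ × R3 → R3} (hG : ContDiff ℝ ∞ G) (v w : R3) (t : ℝ)
    (x : R3) : pullback B G (0, v) (0, w) (t, x) = pullback B (fun x => G (t, x)) v w x := by
  have h : HasFDerivAt (fun x => G (t, x))
      ((fderiv ℝ G (t, x)).comp (ContinuousLinearMap.inr ℝ ℝ R3)) x :=
    (hG.differentiable (by simp) (t, x)).hasFDerivAt.comp x (hasFDerivAt_prodMk_right t x)
  rw [pullback, pullback, h.fderiv]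
  rfl

/-- The homotopy formula: pulling back a divergence free field along the two ends of a homotopy
gives fields that differ by a curl. -/
theorem partialDeriv_homotopyPotential_sub {B : R3 → R3} (hB : ContDiff ℝ ∞ B)
    {G : ℝ × R3 → R3} (hG : ContDiff ℝ ∞ G) {x : R3}
    (hdiv : ∀ t ∈ Icc (0 : ℝ) 1, divFun B (G (t, x)) = 0) (j k : Fin 3) :
    partialDeriv (homotopyPotential B G) j k x - partialDeriv (homotopyPotential B G) k j x =
      pullback B (fun x => G (1, x)) (stdVec j) (stdVec k) x -
        pullback B (fun x => G (0, x)) (stdVec j) (stdVec k) x := by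
  have hc (v w u : ℝ × R3) : Continuous fun t : ℝ => fderiv ℝ (pullback B G v w) (t, x) u :=
    (((contDiff_pullback hB hG v w).continuous_fderiv (by simp)).comp
      (.prodMk_left x)).clm_apply continuous_const
  rw [partialDeriv_homotopyPotential hB hG, partialDeriv_homotopyPotential hB hG,
    ← intervalIntegral.integral_sub ((hc _ _ _).intervalIntegrable 0 1)
      ((hc _ _ _).intervalIntegrable 0 1), ← pullback_slice B hG, ← pullback_slice B hG]
  have hcyc : ∀ t ∈ uIcc (0 : ℝ) 1,
      fderiv ℝ (pullback B G (1, 0) (0, stdVec k)) (t, x) (0, stdVec j) -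
        fderiv ℝ (pullback B G (1, 0) (0, stdVec j)) (t, x) (0, stdVec k) =
      fderiv ℝ (pullback B G (0, stdVec j) (0, stdVec k)) (t, x) (1, 0) := fun t ht => by
    rw [uIcc_of_le zero_le_one] at ht
    have h := fderiv_pullback_cyclic hB hG (1, 0) (0, stdVec j) (0, stdVec k) (t, x)
    rw [hdiv t ht, zero_mul, pullback_swap B G (0, stdVec k) (1, 0), fderiv_neg] at h
    simp only [_root_.neg_apply] at h
    linarith
  rw [intervalIntegral.integral_congr hcyc]
  refine intervalIntegral.integral_eq_sub_of_hasDerivAt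
    (f := fun t => pullback B G (0, stdVec j) (0, stdVec k) (t, x)) (fun t _ => ?_)
    ((hc _ _ _).intervalIntegrable 0 1)
  exact ((contDiff_pullback hB hG _ _).differentiable (by simp) (t, x)).hasFDerivAt.comp_hasDerivAt
    t ((hasDerivAt_id t).prodMk (hasDerivAt_const t x))

theorem curlFun_homotopyPotential {B : R3 → R3} (hB : ContDiff ℝ ∞ B) {G : ℝ × R3 → R3}
    (hG : ContDiff ℝ ∞ G) {x : R3} (hdiv : ∀ t ∈ Icc (0 : ℝ) 1, divFun B (G (t, x)) = 0) :
    curlFun (homotopyPotential B G) x =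
      pullbackField B (fun x => G (1, x)) x - pullbackField B (fun x => G (0, x)) x := by
  ext i
  fin_cases i <;> simp [curlFun, pullbackField, partialDeriv_homotopyPotential_sub hB hG hdiv]

theorem curlFun_add {α α' : R3 → R3} {x : R3} (h : DifferentiableAt ℝ α x)
    (h' : DifferentiableAt ℝ α' x) :
    curlFun (fun x => α x + α' x) x = curlFun α x + curlFun α' x := by
  have he : fderiv ℝ (fun x => α x + α' x) x = fderiv ℝ α x + fderiv ℝ α' x := fderiv_fun_add h h'
  ext i
  fin_cases i <;> simp [curlFun, partialDeriv, he] <;> ring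

theorem curlFun_neg (α : R3 → R3) (x : R3) : curlFun (fun x => -α x) x = -curlFun α x := by
  have he : fderiv ℝ (fun x => -α x) x = -fderiv ℝ α x := fderiv_fun_neg
  ext i
  fin_cases i <;> simp [curlFun, partialDeriv, he] <;> ring

theorem curlFun_congr {α α' : R3 → R3} {x : R3} (h : α =ᶠ[𝓝 x] α') :
    curlFun α x = curlFun α' x := by
  simp only [curlFun, partialDeriv, h.fderiv_eq]

/-! ### Smoothing of homotopies -/

theorem exists_contDiff_dist_lt {E F : Type*} [NormedAddCommGroup E] [NormedSpace ℝ E]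
    [FiniteDimensional ℝ E] [NormedAddCommGroup F] [NormedSpace ℝ F] {g : E → F}
    (hg : Continuous g) {η : ℝ} (hη : 0 < η) :
    ∃ f : E → F, ContDiff ℝ ∞ f ∧ ∀ x, dist (f x) (g x) < η := by
  obtain ⟨f, hf⟩ := exists_contMDiffMap_forall_mem_convex_of_local_const (n := ⊤) 𝓘(ℝ, E)
    (t := fun x => Metric.ball (g x) η) (fun x => convex_ball _ _) fun x => ⟨g x, by
      filter_upwards [(Metric.continuous_iff'.1 hg) x η hη] with y hy
      rwa [Metric.mem_ball, dist_comm]⟩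
  exact ⟨f, f.contMDiff.contDiff, hf⟩

/-- Near a compact set that can be contracted within `U`, a field that is divergence free on a
suitable compact subset of `U` is a curl. -/
theorem ContractibleIn.exists_curlFun_eq {K U : Set R3} (hK : IsCompact K) (hU : IsOpen U)
    (h : ContractibleIn K U) : ∃ L, IsCompact L ∧ K ⊆ L ∧ L ⊆ U ∧ ∀ B : R3 → R3,
      ContDiff ℝ ∞ B → (∀ z ∈ L, divFun B z = 0) →
        ∃ α : R3 → R3, ContDiff ℝ ∞ α ∧ ∀ x ∈ K, curlFun α x = B x := by
  obtain ⟨hKU, p, ⟨H⟩⟩ := h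
  have hcK : CompactSpace K := isCompact_iff_compactSpace.1 hK
  let Hv : C(unitInterval × K, R3) := ⟨fun q => (H q : R3), continuous_subtype_val.comp H.continuous⟩
  have hH0 (x : K) : Hv (0, x) = x := congrArg Subtype.val (H.apply_zero x)
  have hH1 (x : K) : Hv (1, x) = p := congrArg Subtype.val (H.apply_one x)
  have hcomp : IsCompact (range Hv) := isCompact_range Hv.continuous
  have hrU : range Hv ⊆ U := by
    rintro _ ⟨q, rfl⟩
    exact (H q).2
  obtain ⟨η, hη, hηU⟩ := hcomp.exists_cthickening_subset_open hU hrU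
  have hemb : IsClosedEmbedding
      (Prod.map Subtype.val Subtype.val : unitInterval × K → ℝ × R3) :=
    isClosed_Icc.isClosedEmbedding_subtypeVal.prodMap hK.isClosed.isClosedEmbedding_subtypeVal
  have : TietzeExtension R3 := TietzeExtension.of_tvs ℝ
  obtain ⟨g, hg⟩ := ContinuousMap.exists_extension' hemb Hv
  have hg' (t : unitInterval) (x : K) : g ((t : ℝ), (x : R3)) = Hv (t, x) := congrFun hg (t, x)
  obtain ⟨F, hF, hFg⟩ := exists_contDiff_dist_lt g.continuous hη
  have hF0 (x : K) : dist (F (0, x)) x < η := by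
    have := hFg (0, x)
    rwa [show ((0 : ℝ), (x : R3)) = (((0 : unitInterval) : ℝ), (x : R3)) from rfl, hg' 0 x,
      hH0 x] at this
  have hF1 (x : K) : dist (F (1, x)) p < η := by
    have := hFg (1, x)
    rwa [show ((1 : ℝ), (x : R3)) = (((1 : unitInterval) : ℝ), (x : R3)) from rfl, hg' 1 x,
      hH1 x] at this
  refine ⟨Metric.cthickening η (range Hv), hcomp.cthickening, fun x hx => ?_, hηU,
    fun B hB hdiv => ?_⟩
  · exact Metric.self_subset_cthickening _ ⟨(0, ⟨x, hx⟩), hH0 ⟨x, hx⟩⟩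
  have hzero {z : R3} (q : unitInterval × K) (hz : dist z (Hv q) ≤ η) : divFun B z = 0 :=
    hdiv z (Metric.mem_cthickening_of_dist_le z (Hv q) η _ ⟨q, rfl⟩ hz)
  let G₀ : ℝ × R3 → R3 := fun q => q.2 + q.1 • (F (0, q.2) - q.2)
  let G₁ : ℝ × R3 → R3 := fun q => F (1, q.2) + q.1 • ((p : R3) - F (1, q.2))
  have hF0' : ContDiff ℝ ∞ fun q : ℝ × R3 => F (0, q.2) :=
    hF.comp (contDiff_const.prodMk contDiff_snd)
  have hF1' : ContDiff ℝ ∞ fun q : ℝ × R3 => F (1, q.2) :=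
    hF.comp (contDiff_const.prodMk contDiff_snd)
  have hG₀ : ContDiff ℝ ∞ G₀ := contDiff_snd.add (contDiff_fst.smul (hF0'.sub contDiff_snd))
  have hG₁ : ContDiff ℝ ∞ G₁ := hF1'.add (contDiff_fst.smul (contDiff_const.sub hF1'))
  have c₀ := contDiff_homotopyPotential hB hG₀
  have c₁ := contDiff_homotopyPotential hB hF
  have c₂ := contDiff_homotopyPotential hB hG₁
  refine ⟨fun x => -((homotopyPotential B G₀ x + homotopyPotential B F x) +
    homotopyPotential B G₁ x), ((c₀.add c₁).add c₂).neg, fun x hx => ?_⟩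
  have d {α : R3 → R3} (hα : ContDiff ℝ ∞ α) : DifferentiableAt ℝ α x :=
    hα.differentiable (by simp) x
  rw [curlFun_neg, curlFun_add (d (c₀.add c₁)) (d c₂), curlFun_add (d c₀) (d c₁),
    curlFun_homotopyPotential hB hG₀ fun t ht => hzero (0, ⟨x, hx⟩) ?_,
    curlFun_homotopyPotential hB hF fun t ht => hzero (⟨t, ht⟩, ⟨x, hx⟩) ?_,
    curlFun_homotopyPotential hB hG₁ fun t ht => hzero (1, ⟨x, hx⟩) ?_]
  · have e1 : (fun x => G₀ (1, x)) = fun x => F (0, x) := by ext1 x; simp [G₀]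
    have e2 : (fun x => G₀ (0, x)) = fun x => x := by ext1 x; simp [G₀]
    have e3 : (fun x => G₁ (1, x)) = fun _ => (p : R3) := by ext1 x; simp [G₁]
    have e4 : (fun x => G₁ (0, x)) = fun x => F (1, x) := by ext1 x; simp [G₁]
    rw [e1, e2, e3, e4, pullbackField_id, pullbackField_const]
    abel
  · have h1 := hF1 ⟨x, hx⟩
    rw [hH1, dist_eq_norm]
    rw [dist_eq_norm] at h1
    have he : G₁ (t, x) - p = (1 - t) • (F (1, x) - p) := by
      simp only [G₁]
      module
    rw [he, norm_smul, Real.norm_of_nonneg (sub_nonneg.2 ht.2)]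
    exact (mul_le_of_le_one_left (norm_nonneg _) (by linarith [ht.1])).trans h1.le
  · rw [← hg' ⟨t, ht⟩ ⟨x, hx⟩]
    exact (hFg (t, x)).le
  · have h0 := hF0 ⟨x, hx⟩
    rw [hH0, dist_eq_norm]
    rw [dist_eq_norm] at h0
    simp only [G₀, add_sub_cancel_left, norm_smul, Real.norm_of_nonneg ht.1]
    exact (mul_le_of_le_one_left (norm_nonneg _) ht.2).trans h0.le

/-- Cutting off a vector potential near a compact set. -/
theorem exists_vectorTest_eventuallyEq {K U : Set R3} (hK : IsCompact K) (hU : IsOpen U)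
    (hKU : K ⊆ U) {α : R3 → R3} (hα : ContDiff ℝ ∞ α) :
    ∃ f : VectorTest, tsupport f ⊆ U ∧ ∀ x ∈ K, f =ᶠ[𝓝 x] α := by
  obtain ⟨δ, hδ, hδU⟩ := hK.exists_cthickening_subset_open hU hKU
  have hint : K ⊆ interior (Metric.cthickening δ K) :=
    (Metric.self_subset_thickening hδ K).trans
      (interior_maximal (Metric.thickening_subset_cthickening δ K) Metric.isOpen_thickening)
  obtain ⟨χ, hχ1, hχ0, -⟩ := exists_contMDiffMap_one_nhds_of_subset_interior (n := ⊤) 𝓘(ℝ, R3)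
    hK.isClosed hint
  have h0 : ∀ x ∉ Metric.cthickening δ K, χ x • α x = 0 := fun x hx => by simp [hχ0 x hx]
  refine ⟨⟨fun x => χ x • α x, χ.contMDiff.contDiff.smul hα, .intro hK.cthickening h0,
    fun _ _ => trivial⟩, ?_, fun x hx => ?_⟩
  · refine (closure_minimal (fun x hx => ?_) hK.cthickening.isClosed).trans hδU
    by_contra hn
    exact hx (h0 x hn)
  · filter_upwards [hχ1.filter_mono (nhds_le_nhdsSet hx)] with z hz
    change χ z • α z = α z
    rw [hz, one_smul]

end Homotopy

/-! ### The gauge bridge -/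

theorem bridgeSupport_subset_compl {X : Finset R3} {x₁ x₂ : R3} {γ : ℝ → R3} {R : ℝ}
    (hR₁ : ∀ u ∈ Ioo (0 : ℝ) 1, R ≤ u⁻¹ * (1 - u)⁻¹ * ‖γ u - x₁‖)
    (hR₂ : ∀ u ∈ Ioo (0 : ℝ) 1, R ≤ u⁻¹ * (1 - u)⁻¹ * ‖γ u - x₂‖)
    (hRX : ∀ y : R3, ‖y‖ < R → ∀ u ∈ Icc (0 : ℝ) 1, ∀ x ∈ X, x ≠ x₁ → x ≠ x₂ → nbrPath γ y u ≠ x)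
    {s : R3 → ℝ} (hs : tsupport s ⊆ Metric.ball 0 R) {ε : ℝ} (hε : 0 < ε) :
    bridgeSupport γ s ε ⊆ (↑X)ᶜ := by
  rintro _ ⟨⟨u, y⟩, ⟨hu, hy⟩, rfl⟩ hX
  have hu' : u ∈ Ioo (0 : ℝ) 1 := ⟨hε.trans_le hu.1, by linarith [hu.2]⟩
  have hy' : ‖y‖ < R := mem_ball_zero_iff.1 (hs hy)
  exact hRX y hy' u (Ioo_subset_Icc_self hu') _ hX (nbrPath_ne_of_le hR₁ hy' hu')
    (nbrPath_ne_of_le hR₂ hy' hu') rfl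

/-- The test function `b_ε`. -/
def bridgeTest {γ : ℝ → R3} (hγ : ContDiffOn ℝ ∞ γ (Icc 0 1)) (s : ScalarTest) (ε : ℝ)
    (hε : ε ∈ Ioo (0 : ℝ) (1 / 2)) : VectorTest where
  toFun := bridgeFun γ s ε
  contDiff' := contDiff_bridgeFun hγ s hε
  hasCompactSupport' :=
    (isCompact_bridgeSupport hγ s hε.1).of_isClosed_subset (isClosed_tsupport _)
      (tsupport_bridgeFun_subset hγ s hε)
  tsupport_subset' := fun _ _ => trivial

theorem pairing_bridgeTest {γ : ℝ → R3} (hγ : ContDiffOn ℝ ∞ γ (Icc 0 1)) (s : ScalarTest) {ε : ℝ}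
    (hε : ε ∈ Ioo (0 : ℝ) (1 / 2)) (g : VectorTest) :
    pairing (bridgeTest hγ s ε hε) g = ∫ u in ε..(1 - ε), flux γ s g u :=
  integral_inner_bridgeFun hγ s g hε

theorem _root_.StarSubalgebra.coe_inclusion_apply {A : Type*} [Semiring A] [StarRing A]
    [Algebra ℂ A] [StarModule ℂ A] {S T : StarSubalgebra ℂ A} (h : S ≤ T) (a : S) :
    (StarSubalgebra.inclusion h a : A) = a := rfl

theorem coe_functionalAut_inclusion (ℓ : VectorTest →+ ℝ) {O O' : Set R3} (h : O ⊆ O')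
    (a : observables O) :
    (functionalAut ℓ O' (StarSubalgebra.inclusion (observables_mono h) a) : Op) =
      functionalAut ℓ O a :=
  (coe_functionalAut ℓ O' _).trans
    ((congrArg (Ad (expFunctional ℓ)) (StarSubalgebra.coe_inclusion_apply _ a)).trans
      (coe_functionalAut ℓ O a).symm)

theorem functionalAut_obsDivE_of_eq_zero {ℓ : VectorTest →+ ℝ} {s : ScalarTest}
    (h : ℓ (grad s) = 0) (O : Set R3) (hs : tsupport s ⊆ O) :
    functionalAut ℓ O (obsDivE O s hs) = obsDivE O s hs :=
  functionalAut_obsE_of_eq_zero (g := -grad s) (by rw [map_neg, h, neg_zero]) O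
    (tsupport_neg_grad_subset hs)

theorem neg_grad_smearedIndicator_apply (τ : Region) (s : ScalarTest) (x : R3) :
    (-grad (smearedIndicator τ s) : VectorTest) x = τ.surfaceFun s x := by
  rw [surfaceFun_eq, _root_.neg_apply]

theorem bridgeTest_apply {γ : ℝ → R3} (hγ : ContDiffOn ℝ ∞ γ (Icc 0 1)) (s : ScalarTest) {ε : ℝ}
    (hε : ε ∈ Ioo (0 : ℝ) (1 / 2)) (x : R3) : bridgeTest hγ s ε hε x = bridgeFun γ s ε x := rfl

theorem tsupport_bridgeTest_subset {γ : ℝ → R3} (hγ : ContDiffOn ℝ ∞ γ (Icc 0 1)) (s : ScalarTest)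
    {ε : ℝ} (hε : ε ∈ Ioo (0 : ℝ) (1 / 2)) :
    tsupport (bridgeTest hγ s ε hε) ⊆ bridgeSupport γ s ε :=
  tsupport_bridgeFun_subset hγ s hε

theorem pairing_congr_left {f f' g : VectorTest} (h : ∀ x ∈ tsupport g, f x = f' x) :
    pairing f g = pairing f' g := by
  refine integral_congr_ae (.of_forall fun x => ?_)
  by_cases hx : x ∈ tsupport g
  · simp only [h x hx]
  · simp only [image_eq_zero_of_notMem_tsupport hx, inner_zero_right]

/-- On a region that is contractible in the complement of the charges, the bridge functional is the
pairing with a curl. -/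
theorem exists_bridgeFunctional_eq_pairing_curl {X : Finset R3} {γ : ℝ → R3}
    (hγ : ContDiffOn ℝ ∞ γ (Icc 0 1)) (h0 : γ 0 ∈ X) (h1 : γ 1 ∈ X) {R : ℝ} {s : ScalarTest}
    (hs : tsupport s ⊆ Metric.ball 0 R) {O : Set R3} (hOc : IsCompact (closure O))
    (hO : ContractibleIn (closure O) (↑X)ᶜ) :
    ∃ f : VectorTest, tsupport f ⊆ (↑X)ᶜ ∧
      ∀ g : VectorTest, tsupport g ⊆ O → bridgeFunctional hγ s g = pairing (curl f) g := by
  have hXo : IsOpen ((↑X)ᶜ : Set R3) := X.finite_toSet.isClosed.isOpen_compl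
  obtain ⟨L, hL, hOL, hLX, hpot⟩ := hO.exists_curlFun_eq hOc hXo
  have hball (x : R3) (hx : x ∈ X) : ∃ r > 0, Metric.ball x r ⊆ Lᶜ :=
    Metric.isOpen_iff.1 hL.isClosed.isOpen_compl x fun h => hLX h hx
  obtain ⟨r₀, hr₀, hb₀⟩ := hball _ h0
  obtain ⟨r₁, hr₁, hb₁⟩ := hball _ h1
  set r := min r₀ r₁ / 2 with hr
  have hr0 : r < r₀ := by linarith [min_le_left r₀ r₁, lt_min hr₀ hr₁]
  have hr1 : r < r₁ := by linarith [min_le_right r₀ r₁, lt_min hr₀ hr₁]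
  have hrpos : 0 < r := half_pos (lt_min hr₀ hr₁)
  obtain ⟨ε, hε, hnbr⟩ := exists_nbrPath_mem_ball (R := R) hγ hrpos
  set V : Set R3 := (Metric.closedBall (γ 0) r ∪ Metric.closedBall (γ 1) r)ᶜ with hV
  have hVo : IsOpen V := (Metric.isClosed_closedBall.union Metric.isClosed_closedBall).isOpen_compl
  have hLV : L ⊆ V := by
    rintro z hz (h | h)
    · exact hb₀ (Metric.closedBall_subset_ball hr0 h) hz
    · exact hb₁ (Metric.closedBall_subset_ball hr1 h) hz
  have hend : ∀ u ∈ Icc 0 ε, ∀ y ∈ tsupport s, nbrPath γ y u ∉ V ∧ nbrPath γ y (1 - u) ∉ V :=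
    fun u hu y hy => ⟨fun h => h (Or.inl (Metric.ball_subset_closedBall (hnbr u hu y (hs hy)).1)),
      fun h => h (Or.inr (Metric.ball_subset_closedBall (hnbr u hu y (hs hy)).2))⟩
  obtain ⟨α, hα, hcurl⟩ := hpot (bridgeFun γ s ε) (contDiff_bridgeFun hγ s hε) fun z hz =>
    divFun_bridgeFun_eq_zero hγ hε hVo (hend ε (right_mem_Icc.2 hε.1.le)) (hLV hz)
  obtain ⟨f, hfX, hf⟩ := exists_vectorTest_eventuallyEq hOc hXo (hOL.trans hLX) hα
  refine ⟨f, hfX, fun g hg => ?_⟩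
  have hgV : ∀ z ∉ V, g z = 0 := fun z hz =>
    image_eq_zero_of_notMem_tsupport fun h => hz (hLV (hOL (subset_closure (hg h))))
  rw [bridgeFunctional_eq_of_forall hγ hε fun u hu y hy =>
    ⟨hgV _ (hend u hu y hy).1, hgV _ (hend u hu y hy).2⟩, ← pairing_bridgeTest hγ s hε]
  refine pairing_congr_left fun x hx => ?_
  have hxO := subset_closure (hg hx)
  exact ((curlFun_congr (hf x hxO)).trans (hcurl x hxO)).symm

end

end GaugeBridge


open GaugeBridge
theorem lemma3p2 (X : Finset R3) (x₁ x₂ : R3) (hx₁ : x₁ ∈ X) (hx₂ : x₂ ∈ X)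
    (γ : ℝ → R3) (hγ : ContDiffOn ℝ ∞ γ (Icc 0 1)) (hγ_simple : InjOn γ (Icc 0 1))
    (hγ0 : γ 0 = x₁) (hγ1 : γ 1 = x₂)
    (R : ℝ) (hR : 0 < R)
    (hR₁ : ∀ u ∈ Ioo (0 : ℝ) 1, R ≤ u⁻¹ * (1 - u)⁻¹ * ‖γ u - x₁‖)
    (hR₂ : ∀ u ∈ Ioo (0 : ℝ) 1, R ≤ u⁻¹ * (1 - u)⁻¹ * ‖γ u - x₂‖)
    (hRX : ∀ y : R3, ‖y‖ < R → ∀ u ∈ Icc (0 : ℝ) 1, ∀ x ∈ X, x ≠ x₁ → x ≠ x₂ → nbrPath γ y u ≠ x)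
    (q : ℝ) (s : ScalarTest) (hs : tsupport s ⊆ Metric.ball 0 R) (hsq : ∫ x, s x = q) :
    ∃ b : ℝ → VectorTest,
      -- the functions `b_ε` are test functions supported in the complement of `X`
      (∀ ε ∈ Ioo (0 : ℝ) (1 / 2), (∀ x, b ε x = bridgeFun γ s ε x) ∧ tsupport (b ε) ⊆ (↑X)ᶜ) ∧
      -- the gauge bridge on `𝔄(ℝ³)` and its restriction to `𝔄(ℝ³ \ X)`
      ∃ (β : observables univ ≃⋆ₐ[ℂ] observables univ)
        (βX : observables (↑X)ᶜ ≃⋆ₐ[ℂ] observables (↑X)ᶜ),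
        (∀ a : observables univ,
          Tendsto (fun ε => Ad (expA (b ε)) (a : Op)) (𝓝[>] 0) (𝓝 (β a : Op))) ∧
        (∀ a : observables (↑X)ᶜ,
          (β (StarSubalgebra.inclusion (observables_mono (subset_univ _)) a) : Op) = βX a) ∧
        -- (i)
        (∀ (s' : ScalarTest) (hs' : tsupport s' ⊆ (↑X)ᶜ),
          βX (obsDivE (↑X)ᶜ s' hs') = obsDivE (↑X)ᶜ s' hs') ∧
        -- (ii)
        (∀ τ : Region, τ.surface ⊆ (↑X)ᶜ → ∃ δ > 0, ∀ s' : ScalarTest,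
          tsupport s' ⊆ Metric.ball 0 δ → ∫ x, s' x = 1 →
          ∃ (g : VectorTest) (hg : tsupport g ⊆ (↑X)ᶜ), (∀ x, g x = τ.surfaceFun s' x) ∧
            (x₁ ∉ τ.carrier → x₂ ∉ τ.carrier →
              βX (obsE (↑X)ᶜ g hg) = obsE (↑X)ᶜ g hg) ∧
            (x₁ ∈ τ.carrier → x₂ ∉ τ.carrier →
              βX (obsE (↑X)ᶜ g hg) = Complex.exp (Complex.I * q) • obsE (↑X)ᶜ g hg) ∧
            (x₁ ∉ τ.carrier → x₂ ∈ τ.carrier →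
              βX (obsE (↑X)ᶜ g hg) = Complex.exp (-(Complex.I * q)) • obsE (↑X)ᶜ g hg) ∧
            (x₁ ∈ τ.carrier → x₂ ∈ τ.carrier →
              βX (obsE (↑X)ᶜ g hg) = obsE (↑X)ᶜ g hg)) ∧
        -- (iii)
        (∀ O : Set R3, IsOpen O → IsCompact (closure O) → ContractibleIn (closure O) (↑X)ᶜ →
          ∃ f : VectorTest, tsupport f ⊆ (↑X)ᶜ ∧
            ∀ a : observables (↑X)ᶜ, (a : Op) ∈ observables O →
              (βX a : Op) = Ad (expB f) a) := by
  classical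
  let b : ℝ → VectorTest := fun ε =>
    if hε : ε ∈ Ioo (0 : ℝ) (1 / 2) then bridgeTest hγ s ε hε else 0
  have hb {ε : ℝ} (hε : ε ∈ Ioo (0 : ℝ) (1 / 2)) : b ε = bridgeTest hγ s ε hε := dif_pos hε
  set ℓ := bridgeFunctional hγ s with hℓ
  have hgrad (s' : ScalarTest) : ℓ (grad s') = q * (s' x₂ - s' x₁) := by
    rw [hℓ, bridgeFunctional_grad, hsq, hγ0, hγ1]
  have hlim (g : VectorTest) : Tendsto (fun ε => pairing (b ε) g) (𝓝[>] 0) (𝓝 (ℓ g)) := by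
    refine (tendsto_integral_flux hγ s g).congr' ?_
    filter_upwards [Ioo_mem_nhdsGT (show (0 : ℝ) < 1 / 2 by norm_num)] with ε hε
    rw [hb hε, pairing_bridgeTest]
  refine ⟨b, fun ε hε => ⟨fun x => by rw [hb hε, bridgeTest_apply], ?_⟩, functionalAut ℓ univ,
    functionalAut ℓ (↑X)ᶜ, fun a => tendsto_Ad_expA hlim a.2.1, coe_functionalAut_inclusion ℓ (subset_univ _), ?_, ?_, ?_⟩
  · rw [hb hε]
    exact (tsupport_bridgeTest_subset hγ s hε).trans
      (bridgeSupport_subset_compl hR₁ hR₂ hRX hs hε.1)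
  · intro s' hs'
    have h0 {x : R3} (hx : x ∈ X) : s' x = 0 :=
      image_eq_zero_of_notMem_tsupport fun h => hs' h hx
    refine functionalAut_obsDivE_of_eq_zero ?_ (↑X)ᶜ hs'
    rw [hgrad, h0 hx₁, h0 hx₂, sub_self, mul_zero]
  · intro τ hτ
    obtain ⟨δ, hδ, h⟩ := exists_surface_test τ X.finite_toSet hτ
    refine ⟨δ, hδ, fun s' hs' h1 => ?_⟩
    obtain ⟨hsupp, hval⟩ := h s' hs' h1
    have hg : ℓ (-grad (smearedIndicator τ s')) =
        q * (smearedIndicator τ s' x₁ - smearedIndicator τ s' x₂) := by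
      rw [map_neg, hgrad]
      ring
    refine ⟨_, hsupp, neg_grad_smearedIndicator_apply τ s', fun m₁ m₂ => ?_, fun m₁ m₂ => ?_,
      fun m₁ m₂ => ?_, fun m₁ m₂ => ?_⟩
    · refine functionalAut_obsE_of_eq_zero ?_ _ _
      rw [hg, (hval x₁ hx₁).2 m₁, (hval x₂ hx₂).2 m₂, sub_self, mul_zero]
    · rw [functionalAut_obsE, hg, (hval x₁ hx₁).1 m₁, (hval x₂ hx₂).2 m₂, sub_zero, mul_one]
    · rw [functionalAut_obsE, hg, (hval x₁ hx₁).2 m₁, (hval x₂ hx₂).1 m₂, zero_sub, mul_neg,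
        mul_one, Complex.ofReal_neg, mul_neg]
    · refine functionalAut_obsE_of_eq_zero ?_ _ _
      rw [hg, (hval x₁ hx₁).1 m₁, (hval x₂ hx₂).1 m₂, sub_self, mul_zero]
  · intro O _ hOc hO
    obtain ⟨f, hf, hfg⟩ := exists_bridgeFunctional_eq_pairing_curl hγ (hγ0 ▸ hx₁) (hγ1 ▸ hx₂) hs
      hOc hO
    exact ⟨f, hf, fun a ha => Ad_expFunctional_eq_Ad_expA hfg ha.1⟩
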